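/- Let $\mu\in\mathbb{C}$ with $\operatorname{Re}\mu<1/2$. For real $z>1$ let $$P^\mu_\nu(z)=\frac{1}{\Gamma(1-\mu)}\left(\frac{z+1}{z-1}\right)^{\mu/2}{}_2F_1\left(-\nu,1+\nu;1-\mu;\frac{1-z}{2}\right)$$ be the associated Legendre function of the first kind (with ${}_2F_1$ denoting, for $z\ge 3$, the analytic continuation of the hypergeometric series), and for $\omega>0$ let $$P^\mu_\nu(z,\omega)=\sqrt{\frac{2}{\pi}}\,\frac{\Gamma(1/2-\mu)\,(z^2-1)^{-\mu/2}}{\Gamma(1+\nu-\mu)\,\Gamma(-\nu-\mu)}\int_0^\omega\frac{\cosh(t(\nu+1/2))}{(\cosh t+z)^{1/2-\mu}}\,dt$$ be the incomplete Legendre integral. Let $\psi:\mathbb{R}\to\mathbb{C}$ be $2\pi$-periodic with $\psi\in C^1[-\pi,\pi]$, and let $$f(t)=(t^2-1)^{-\mu/2}\int_{-\pi}^{\pi}\frac{\psi(u)\sinh(u)}{(t+\cosh u)^{3/2-\mu}}\,du,\qquad t>1.$$ Then for every integer $n\ge1$ the function $P^\mu_{in-1/2}(t)f(t)$ is absolutely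 integrable over $(1,\infty)$, and for every $x>1$ $$f(x)=\frac1\pi\sum_{n=1}^\infty n\sinh(\pi n)\,\Gamma\left(\tfrac12+in-\mu\right)\Gamma\left(\tfrac12-in-\mu\right)P^\mu_{in-1/2}(x,\pi)\int_1^\infty P^\mu_{in-1/2}(t)f(t)\,dt,$$ where the series converges absolutely. -/

import Mathlib

open MeasureTheory Set

noncomputable section

/-- The Gauss hypergeometric function `₂F₁(a, b; c; z)` for `‖z‖ < 1` or `Re z < 1 / 2`:
the hypergeometric series inside the unit disc, and outside of it the analytic continuation of
that series, written with the Pfaff transformation (for `Re z < 1 / 2` one has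
`‖z / (z - 1)‖ < 1`, and on the overlap of the two regions both expressions agree). -/
def gaussHyp (a b c z : ℂ) : ℂ :=
  if ‖z‖ < 1 then ordinaryHypergeometric a b c z
  else (1 - z) ^ (-a) * ordinaryHypergeometric a (c - b) c (z / (z - 1))

/-- The associated Legendre function of the first kind `P^μ_ν(z)` for real `z > 1`. -/
def legendreP (μ ν : ℂ) (z : ℝ) : ℂ :=
  1 / Complex.Gamma (1 - μ) * (((z + 1) / (z - 1) : ℝ) : ℂ) ^ (μ / 2) *
    gaussHyp (-ν) (1 + ν) (1 - μ) (((1 - z) / 2 : ℝ) : ℂ)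

/-- The incomplete Legendre integral `P^μ_ν(z, ω)` for real `z > 1`, `ω > 0`. -/
def incompleteLegendreP (μ ν : ℂ) (z ω : ℝ) : ℂ :=
  ((Real.sqrt (2 / Real.pi) : ℝ) : ℂ) *
    (Complex.Gamma (1 / 2 - μ) * ((z ^ 2 - 1 : ℝ) : ℂ) ^ (-μ / 2) /
      (Complex.Gamma (1 + ν - μ) * Complex.Gamma (-ν - μ))) *
    ∫ t in (0 : ℝ)..ω,
      Complex.cosh ((t : ℂ) * (ν + 1 / 2)) / ((Real.cosh t + z : ℝ) : ℂ) ^ (1 / 2 - μ)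

end

/-! The expansion is Parseval's identity in disguise. Up to the factor `(x² - 1)^(-μ/2)`, `f x` is
the pairing over `[-π, π]` of `ψ` with the odd kernel `K(u) = sinh u / (x + cosh u)^(3/2 - μ)`.
Since `K` is odd, only sine coefficients enter: `∫ ψ K = (1/π) ∑ (∫ ψ sin nu)(∫ K sin nu)`
(`hasSum_sin_mul_sin`). Convergence as a `HasSum` in `ℂ` is absolute.

Both coefficients are Legendre quantities. One integration by parts turns `∫ K sin nu` into the
incomplete Legendre integral (`incompleteLegendreP_pi`). The coefficient `∫ ψ sin nu` is a multiple
of `∫ P f` (`integral_legendreP_mul`), which is the hard part. There `t = 1 + 2s`, `P` is replaced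
by Euler's integral, and Fubini leaves a Stieltjes transform in `s` at `z = cosh²(u/2)`. The
rescaling in `stieltjes_euler` and the substitution `x = t(1 + t)/(t + z)` in
`sinh_mul_integral_cpow` reduce it, after multiplication by `sinh u`, to an elementary integral
proportional to `sin(νu)/ν` (`integral_cpow_mul_sub_exp`). The Gamma factors then collapse by
reflection. -/

/-! ### Beta integrals on the half-line and the unit interval. -/

theorem ofReal_cpow_eq_exp {x : ℝ} (hx : 0 < x) (s : ℂ) :
    (x : ℂ) ^ s = Complex.exp ((Real.log x : ℂ) * s) := by
  rw [Complex.cpow_def_of_ne_zero (by exact_mod_cast hx.ne'), Complex.ofReal_log hx.le]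

theorem image_div_one_sub : (fun y : ℝ => y / (1 - y)) '' Ioo 0 1 = Ioi 0 := by
  ext x
  constructor
  · rintro ⟨y, hy, rfl⟩
    exact div_pos hy.1 (by linarith [hy.2])
  · intro hx
    have hx : 0 < x := hx
    refine ⟨x / (1 + x), ⟨by positivity, by rw [div_lt_one (by positivity)]; linarith⟩, ?_⟩
    simp only
    field_simp
    ring

theorem hasDerivWithinAt_div_one_sub {y : ℝ} (hy : y ∈ Ioo (0 : ℝ) 1) :
    HasDerivWithinAt (fun y : ℝ => y / (1 - y)) (((1 - y) ^ 2)⁻¹) (Ioo 0 1) y := by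
  have h : (1 - y) ≠ 0 := by linarith [hy.2]
  have := ((hasDerivAt_id y).div ((hasDerivAt_const y (1 : ℝ)).sub (hasDerivAt_id y)) h)
  refine (this.congr_deriv ?_).hasDerivWithinAt
  simp only [Pi.sub_apply, id]
  field_simp
  ring

theorem injOn_div_one_sub : InjOn (fun y : ℝ => y / (1 - y)) (Ioo 0 1) := by
  intro x hx y hy h
  have h1 : (1 - x) ≠ 0 := by linarith [hx.2]
  have h2 : (1 - y) ≠ 0 := by linarith [hy.2]
  simp only at h
  rw [div_eq_div_iff h1 h2] at h
  linarith

theorem integral_Ioi_eq_integral_Ioo (g : ℝ → ℂ) :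
    ∫ x in Ioi (0 : ℝ), g x = ∫ y in Ioo (0 : ℝ) 1, ((1 - y) ^ 2)⁻¹ • g (y / (1 - y)) := by
  rw [← image_div_one_sub, integral_image_eq_integral_abs_deriv_smul measurableSet_Ioo
    (fun y hy => hasDerivWithinAt_div_one_sub hy) injOn_div_one_sub]
  refine setIntegral_congr_fun measurableSet_Ioo fun y hy => ?_
  simp only [abs_of_nonneg (inv_nonneg.2 (sq_nonneg (1 - y)))]

theorem integrableOn_Ioi_iff_integrableOn_Ioo (g : ℝ → ℂ) :
    IntegrableOn g (Ioi 0) ↔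
      IntegrableOn (fun y : ℝ => ((1 - y) ^ 2)⁻¹ • g (y / (1 - y))) (Ioo 0 1) := by
  rw [← image_div_one_sub, integrableOn_image_iff_integrableOn_abs_deriv_smul measurableSet_Ioo
    (fun y hy => hasDerivWithinAt_div_one_sub hy) injOn_div_one_sub]
  refine integrableOn_congr_fun (fun y hy => ?_) measurableSet_Ioo
  simp only [abs_of_nonneg (inv_nonneg.2 (sq_nonneg (1 - y)))]

/-- Under `x = y/(1 - y)` the powers of `1 - y` add up to `-2 - (p - 1) + (p + q) = q - 1`. Once
every power is an exponential of a logarithm, the identity is linear in the exponents; later power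
identities are proved the same way. -/
theorem beta_kernel_comp {A B : ℝ} (hA : 0 < A) (hB : 0 < B) (p q : ℂ) {y : ℝ}
    (hy : y ∈ Ioo (0 : ℝ) 1) :
    ((1 - y) ^ 2)⁻¹ • (((y / (1 - y) : ℝ) : ℂ) ^ (p - 1) *
      ((A * (y / (1 - y)) + B : ℝ) : ℂ) ^ (-(p + q))) =
    (y : ℂ) ^ (p - 1) * ((1 - y : ℝ) : ℂ) ^ (q - 1) *
      ((A * y + B * (1 - y) : ℝ) : ℂ) ^ (-(p + q)) := by
  have hy0 : 0 < y := hy.1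
  have h1 : 0 < 1 - y := by linarith [hy.2]
  have h2 : 0 < A * y + B * (1 - y) := by positivity
  have e : A * (y / (1 - y)) + B = (A * y + B * (1 - y)) / (1 - y) := by field_simp
  have e2 : (((1 - y) ^ 2)⁻¹ : ℝ) = Real.exp (-2 * Real.log (1 - y)) := by
    rw [show -2 * Real.log (1 - y) = -(Real.log (1 - y) + Real.log (1 - y)) by ring, Real.exp_neg,
      Real.exp_add, Real.exp_log h1, sq]
  rw [e, Complex.real_smul, e2, ofReal_cpow_eq_exp (by positivity), ofReal_cpow_eq_exp (by positivity),
    ofReal_cpow_eq_exp hy0, ofReal_cpow_eq_exp h1, ofReal_cpow_eq_exp h2,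
    Real.log_div hy0.ne' h1.ne', Real.log_div h2.ne' h1.ne', Complex.ofReal_exp]
  simp only [← Complex.exp_add]
  congr 1
  push_cast
  ring

theorem integral_beta_Ioi_one (p q : ℂ) :
    ∫ x in Ioi (0 : ℝ), (x : ℂ) ^ (p - 1) * ((x + 1 : ℝ) : ℂ) ^ (-(p + q)) =
      Complex.betaIntegral p q := by
  rw [integral_Ioi_eq_integral_Ioo, Complex.betaIntegral, intervalIntegral.integral_of_le zero_le_one,
    integral_Ioc_eq_integral_Ioo]
  refine setIntegral_congr_fun measurableSet_Ioo fun y hy => ?_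
  have := beta_kernel_comp one_pos one_pos p q hy
  simp only [one_mul, add_sub_cancel] at this
  simp only [this]
  simp

theorem integrableOn_beta_Ioi_one {p q : ℂ} (hp : 0 < p.re) (hq : 0 < q.re) :
    IntegrableOn (fun x : ℝ => (x : ℂ) ^ (p - 1) * ((x + 1 : ℝ) : ℂ) ^ (-(p + q))) (Ioi 0) := by
  rw [integrableOn_Ioi_iff_integrableOn_Ioo]
  have := (intervalIntegrable_iff_integrableOn_Ioo_of_le zero_le_one).1
    (Complex.betaIntegral_convergent hp hq)
  refine this.congr_fun (fun y hy => ?_) measurableSet_Ioo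
  have := beta_kernel_comp one_pos one_pos p q hy
  simp only [one_mul, add_sub_cancel] at this
  simp only [this]
  simp

theorem beta_kernel_scale {A B : ℝ} (hA : 0 < A) (hB : 0 < B) (p q : ℂ) {x : ℝ} (hx : 0 < x) :
    (x : ℂ) ^ (p - 1) * ((A * x + B : ℝ) : ℂ) ^ (-(p + q)) =
    ((A : ℂ) ^ (1 - p) * (B : ℂ) ^ (-q - 1)) * (((A / B * x : ℝ) : ℂ) ^ (p - 1) *
      ((A / B * x + 1 : ℝ) : ℂ) ^ (-(p + q))) := by
  have e : A * x + B = B * (A / B * x + 1) := by field_simp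
  have h2 : 0 < A / B * x + 1 := by positivity
  rw [e, ofReal_cpow_eq_exp hx, ofReal_cpow_eq_exp (by positivity), ofReal_cpow_eq_exp hA,
    ofReal_cpow_eq_exp hB, ofReal_cpow_eq_exp h2, ofReal_cpow_eq_exp (by positivity),
    Real.log_mul hB.ne' h2.ne', Real.log_mul (by positivity) hx.ne', Real.log_div hA.ne' hB.ne']
  simp only [← Complex.exp_add]
  congr 1
  push_cast
  ring

theorem integral_beta_Ioi {A B : ℝ} (hA : 0 < A) (hB : 0 < B) (p q : ℂ) :
    ∫ x in Ioi (0 : ℝ), (x : ℂ) ^ (p - 1) * ((A * x + B : ℝ) : ℂ) ^ (-(p + q)) =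
      (A : ℂ) ^ (-p) * (B : ℂ) ^ (-q) * Complex.betaIntegral p q := by
  rw [setIntegral_congr_fun measurableSet_Ioi
    (fun x hx => beta_kernel_scale hA hB p q (mem_Ioi.1 hx)), integral_const_mul,
    integral_comp_mul_left_Ioi (fun x : ℝ => (x : ℂ) ^ (p - 1) * ((x + 1 : ℝ) : ℂ) ^ (-(p + q))) 0
      (div_pos hA hB), mul_zero, integral_beta_Ioi_one, Complex.real_smul, ← mul_assoc]
  congr 1
  rw [inv_div, ← Real.exp_log (div_pos hB hA), Real.log_div hB.ne' hA.ne', ofReal_cpow_eq_exp hA,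
    ofReal_cpow_eq_exp hB, ofReal_cpow_eq_exp hA, ofReal_cpow_eq_exp hB, Complex.ofReal_exp]
  simp only [← Complex.exp_add]
  congr 1
  push_cast
  ring

theorem integrableOn_beta_Ioi {A B : ℝ} (hA : 0 < A) (hB : 0 < B) {p q : ℂ}
    (hp : 0 < p.re) (hq : 0 < q.re) :
    IntegrableOn (fun x : ℝ => (x : ℂ) ^ (p - 1) * ((A * x + B : ℝ) : ℂ) ^ (-(p + q))) (Ioi 0) := by
  have h := (integrableOn_Ioi_comp_mul_left_iff
    (fun x : ℝ => (x : ℂ) ^ (p - 1) * ((x + 1 : ℝ) : ℂ) ^ (-(p + q))) 0 (div_pos hA hB)).2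
    (by rw [mul_zero]; exact integrableOn_beta_Ioi_one hp hq)
  exact IntegrableOn.congr_fun (h.const_mul ((A : ℂ) ^ (1 - p) * (B : ℂ) ^ (-q - 1)))
    (fun x hx => (beta_kernel_scale hA hB p q (mem_Ioi.1 hx)).symm) measurableSet_Ioi

theorem integral_beta_Ioo {A B : ℝ} (hA : 0 < A) (hB : 0 < B) (p q : ℂ) :
    ∫ y in Ioo (0 : ℝ) 1, (y : ℂ) ^ (p - 1) * ((1 - y : ℝ) : ℂ) ^ (q - 1) *
      ((A * y + B * (1 - y) : ℝ) : ℂ) ^ (-(p + q)) =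
      (A : ℂ) ^ (-p) * (B : ℂ) ^ (-q) * Complex.betaIntegral p q := by
  rw [← integral_beta_Ioi hA hB, integral_Ioi_eq_integral_Ioo]
  exact setIntegral_congr_fun measurableSet_Ioo
    (fun y hy => (beta_kernel_comp hA hB p q hy).symm)

/-! ### Binomial series and Euler's integral. -/

theorem hasSum_one_sub_cpow (a : ℂ) {w : ℂ} (hw : ‖w‖ < 1) :
    HasSum (fun k : ℕ => (k.factorial : ℂ)⁻¹ * (ascPochhammer ℂ k).eval a * w ^ k)
      ((1 - w) ^ (-a)) := by
  have h := (Complex.one_add_cpow_hasFPowerSeriesOnBall_zero (a := -a)).hasSum (y := -w)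
    (by rw [← ENNReal.ofReal_one, Metric.eball_ofReal]; simpa using hw)
  -- The parameter `b` occurs above and below and cancels; `1` is a value at which no Pochhammer
  -- symbol vanishes.
  rw [binomialSeries_eq_ordinaryHypergeometricSeries (b := (1 : ℂ))
    (fun k hk => by
      have := congrArg Complex.re hk
      simp at this
      have h0 : (0 : ℝ) ≤ k := k.cast_nonneg
      linarith)] at h
  rw [zero_add, ← sub_eq_add_neg] at h
  refine h.congr_fun fun k => ?_
  have h1 : (ascPochhammer ℂ k).eval 1 ≠ 0 := by
    rw [ascPochhammer_eval_one]; exact_mod_cast k.factorial_ne_zero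
  rw [ordinaryHypergeometricSeries, FormalMultilinearSeries.ofScalars_comp_neg_id,
    FormalMultilinearSeries.ofScalars_apply_eq, ordinaryHypergeometricCoefficient, neg_neg,
    mul_inv_cancel_right₀ h1, smul_eq_mul, neg_pow w]
  have : ((-1 : ℂ) ^ k) * (-1) ^ k = 1 := by rw [← mul_pow]; simp
  linear_combination (-(k.factorial : ℂ)⁻¹ * (ascPochhammer ℂ k).eval a * w ^ k) * this

theorem integrableOn_beta_Ioo {p q : ℂ} (hp : 0 < p.re) (hq : 0 < q.re) :
    IntegrableOn (fun y : ℝ => (y : ℂ) ^ (p - 1) * ((1 - y : ℝ) : ℂ) ^ (q - 1)) (Ioo 0 1) := by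
  have := (intervalIntegrable_iff_integrableOn_Ioo_of_le zero_le_one).1
    (Complex.betaIntegral_convergent hp hq)
  simpa using this

theorem integral_beta_Ioo_one (p q : ℂ) :
    ∫ y in Ioo (0 : ℝ) 1, (y : ℂ) ^ (p - 1) * ((1 - y : ℝ) : ℂ) ^ (q - 1) =
      Complex.betaIntegral p q := by
  rw [Complex.betaIntegral, intervalIntegral.integral_of_le zero_le_one,
    integral_Ioc_eq_integral_Ioo]
  simp

/-- Supplies the factor `(p)_k / (p + q)_k` of the hypergeometric coefficients when Euler's integral
is expanded termwise. -/
theorem betaIntegral_add_nat {p q : ℂ} (hp : 0 < p.re) (hq : 0 < q.re) (k : ℕ) :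
    Complex.betaIntegral (p + k) q =
      (ascPochhammer ℂ k).eval p * ((ascPochhammer ℂ k).eval (p + q))⁻¹ *
        Complex.betaIntegral p q := by
  have key : ∀ z : ℂ, 0 < z.re → Complex.Gamma (z + k) =
      (ascPochhammer ℂ k).eval z * Complex.Gamma z := fun z hz => by
    rw [← Complex.Gamma_add_nat_div_Gamma_eq, div_mul_cancel₀ _ (Complex.Gamma_ne_zero_of_re_pos hz)]
    intro m hm
    rw [hm] at hz
    simp at hz
    have h0 : (0 : ℝ) ≤ m := m.cast_nonneg
    linarith
  have hpk : 0 < (p + k).re := by simp; positivity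
  rw [Complex.betaIntegral_eq_Gamma_mul_div _ _ hpk hq, Complex.betaIntegral_eq_Gamma_mul_div _ _ hp hq,
    add_right_comm, key p hp, key (p + q) (by simp; positivity)]
  rw [div_eq_mul_inv, div_eq_mul_inv, mul_inv]
  ring

/-- Euler's integral for the Gauss hypergeometric function inside the unit disc. -/
theorem euler_integral (a : ℂ) {p q z : ℂ} (hp : 0 < p.re) (hq : 0 < q.re) (hz : ‖z‖ < 1) :
    ∫ y in Ioo (0 : ℝ) 1, (y : ℂ) ^ (p - 1) * ((1 - y : ℝ) : ℂ) ^ (q - 1) *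
      (1 - z * y) ^ (-a) =
    Complex.betaIntegral p q * ordinaryHypergeometric a p (p + q) z := by
  set A : ℕ → ℂ := fun k => (k.factorial : ℂ)⁻¹ * (ascPochhammer ℂ k).eval a with hA
  set W : ℝ → ℂ := fun y => (y : ℂ) ^ (p - 1) * ((1 - y : ℝ) : ℂ) ^ (q - 1) with hW
  have hWi : IntegrableOn W (Ioo 0 1) := integrableOn_beta_Ioo hp hq
  -- The binomial series at the real point `‖z‖` gives a majorant uniform in `y`.
  have hsum : Summable fun k => ‖A k‖ * ‖z‖ ^ k := by
    have := (hasSum_one_sub_cpow a (w := (‖z‖ : ℂ)) (by simpa using hz)).summable.norm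
    simpa [hA] using this
  have hzy : ∀ y ∈ Ioo (0 : ℝ) 1, ‖z * y‖ ≤ ‖z‖ := fun y hy => by
    rw [norm_mul, Complex.norm_real, Real.norm_of_nonneg hy.1.le]
    exact mul_le_of_le_one_right (norm_nonneg _) hy.2.le
  have hmain : HasSum (fun k => ∫ y in Ioo (0 : ℝ) 1, W y * (A k * (z * y) ^ k))
      (∫ y in Ioo (0 : ℝ) 1, W y * (1 - z * y) ^ (-a)) := by
    refine hasSum_integral_of_dominated_convergence
      (fun k y => ‖W y‖ * (‖A k‖ * ‖z‖ ^ k)) (fun k => ?_) (fun k => ?_) ?_ ?_ ?_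
    · exact hWi.aestronglyMeasurable.mul (by fun_prop)
    · refine (ae_restrict_mem measurableSet_Ioo).mono fun y hy => ?_
      rw [norm_mul (W y), norm_mul (A k), norm_pow]
      gcongr
      exact hzy y hy
    · exact Filter.Eventually.of_forall fun y => hsum.mul_left _
    · simp_rw [tsum_mul_left]
      exact hWi.norm.mul_const _
    · refine (ae_restrict_mem measurableSet_Ioo).mono fun y hy => ?_
      exact (hasSum_one_sub_cpow a ((hzy y hy).trans_lt hz)).mul_left _
  rw [← hmain.tsum_eq, ordinaryHypergeometric_eq_tsum, ← tsum_mul_left]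
  refine tsum_congr fun k => ?_
  have : ∀ y ∈ Ioo (0 : ℝ) 1, W y * (A k * (z * y) ^ k) =
      A k * z ^ k * ((y : ℂ) ^ (p + k - 1) * ((1 - y : ℝ) : ℂ) ^ (q - 1)) := fun y hy => by
    rw [add_sub_right_comm, Complex.cpow_add _ _ (by exact_mod_cast hy.1.ne'), Complex.cpow_natCast,
      mul_pow]
    simp only [hW]
    ring
  rw [setIntegral_congr_fun measurableSet_Ioo this, integral_const_mul, integral_beta_Ioo_one,
    betaIntegral_add_nat hp hq, smul_eq_mul]
  ring

/-- Euler's integral for `gaussHyp` on the negative real axis. -/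
theorem gaussHyp_neg (a : ℂ) {p q : ℂ} (hp : 0 < p.re) (hq : 0 < q.re) {s : ℝ} (hs : 0 < s) :
    ∫ y in Ioo (0 : ℝ) 1, (y : ℂ) ^ (p - 1) * ((1 - y : ℝ) : ℂ) ^ (q - 1) *
      ((1 + s * y : ℝ) : ℂ) ^ (-a) =
    Complex.betaIntegral p q * gaussHyp a p (p + q) ((-s : ℝ) : ℂ) := by
  unfold gaussHyp
  split_ifs with h
  · rw [← euler_integral a hp hq h]
    refine setIntegral_congr_fun measurableSet_Ioo fun y hy => ?_
    push_cast
    ring_nf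
  · have hs1 : 0 < 1 + s := by linarith
    have hw : ‖((-s : ℝ) : ℂ) / (((-s : ℝ) : ℂ) - 1)‖ < 1 := by
      rw [show ((-s : ℝ) : ℂ) / (((-s : ℝ) : ℂ) - 1) = ((-s / (-s - 1) : ℝ) : ℂ) by push_cast; rfl,
        Complex.norm_real, show -s / (-s - 1) = s / (1 + s) by
          rw [div_eq_div_iff (by linarith) hs1.ne']; ring, Real.norm_of_nonneg (by positivity),
        div_lt_one hs1]
      linarith
    -- In the Pfaff branch `p` and `q` trade places: the reflection `y ↦ 1 - y` turns `1 + s y` into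
    -- `(1 + s)(1 - s y/(1 + s))`.
    have hE := euler_integral a hq hp hw
    rw [Complex.betaIntegral_symm p q, add_comm q p] at hE
    rw [add_sub_cancel_left, mul_left_comm, ← hE, ← integral_const_mul,
      ← integral_Ioc_eq_integral_Ioo, ← integral_Ioc_eq_integral_Ioo,
      ← intervalIntegral.integral_of_le zero_le_one, ← intervalIntegral.integral_of_le zero_le_one]
    have hsub := intervalIntegral.integral_comp_sub_left (a := 0) (b := 1)
      (fun y : ℝ => (y : ℂ) ^ (p - 1) * ((1 - y : ℝ) : ℂ) ^ (q - 1) *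
      ((1 + s * y : ℝ) : ℂ) ^ (-a)) 1
    rw [sub_self, sub_zero] at hsub
    rw [← hsub, intervalIntegral.integral_of_le zero_le_one,
      intervalIntegral.integral_of_le zero_le_one,
      integral_Ioc_eq_integral_Ioo, integral_Ioc_eq_integral_Ioo]
    refine setIntegral_congr_fun measurableSet_Ioo fun y hy => ?_
    have h2 : 0 ≤ 1 - s / (1 + s) * y := by
      have : s / (1 + s) * y ≤ 1 := by
        rw [div_mul_eq_mul_div, div_le_one hs1]; nlinarith [hy.1, hy.2]
      linarith
    have e : ((1 + s * (1 - y) : ℝ) : ℂ) ^ (-a) =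
        (1 - ((-s : ℝ) : ℂ)) ^ (-a) *
          (1 - ((-s : ℝ) : ℂ) / (((-s : ℝ) : ℂ) - 1) * y) ^ (-a) := by
      have e1 : 1 + s * (1 - y) = (1 + s) * (1 - s / (1 + s) * y) := by field_simp; ring
      have e2 : (1 - ((-s : ℝ) : ℂ)) = ((1 + s : ℝ) : ℂ) := by push_cast; ring
      have e3 : (1 - ((-s : ℝ) : ℂ) / (((-s : ℝ) : ℂ) - 1) * y) =
          ((1 - s / (1 + s) * y : ℝ) : ℂ) := by
        have : -s / (-s - 1) = s / (1 + s) := by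
          rw [div_eq_div_iff (by linarith) hs1.ne']; ring
        rw [← this]; push_cast; rfl
      rw [e1, e2, e3, Complex.ofReal_mul, Complex.mul_cpow_ofReal_nonneg hs1.le h2]
    rw [e, sub_sub_cancel]
    ring

/-! ### Stieltjes transform of Euler's integral. -/

/-- Swap, rescale `s = t/y` for fixed `y`, and swap back; the rescaling preserves the norm
integrals, so the second swap is also legitimate. -/
theorem integral_integral_comp_div {F : ℝ → ℝ → ℂ} (hm : Measurable (Function.uncurry F))
    (hF : Integrable (Function.uncurry F)
      ((volume.restrict (Ioi 0)).prod (volume.restrict (Ioo 0 1)))) :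
    ∫ s in Ioi (0 : ℝ), ∫ y in Ioo (0 : ℝ) 1, F s y =
      ∫ t in Ioi (0 : ℝ), ∫ y in Ioo (0 : ℝ) 1, y⁻¹ • F (t * y⁻¹) y := by
  have hscale : ∀ y ∈ Ioo (0 : ℝ) 1, ∫ s in Ioi (0 : ℝ), F s y =
      ∫ t in Ioi (0 : ℝ), y⁻¹ • F (t * y⁻¹) y := fun y hy => by
    rw [integral_smul, integral_comp_mul_right_Ioi' (fun s => F s y) 0 (inv_pos.2 hy.1), zero_mul]
  have hG : Integrable (Function.uncurry fun t y : ℝ => y⁻¹ • F (t * y⁻¹) y)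
      ((volume.restrict (Ioi 0)).prod (volume.restrict (Ioo 0 1))) := by
    have hmG : Measurable (Function.uncurry fun t y : ℝ => y⁻¹ • F (t * y⁻¹) y) := by
      have h1 : Measurable fun x : ℝ × ℝ => (x.1 * x.2⁻¹, x.2) := by fun_prop
      exact (measurable_snd.inv).smul (hm.comp h1)
    rw [integrable_prod_iff' hF.aestronglyMeasurable] at hF
    rw [integrable_prod_iff' hmG.aestronglyMeasurable]
    refine ⟨?_, ?_⟩
    · filter_upwards [hF.1, ae_restrict_mem measurableSet_Ioo] with y h hy
      have := (integrableOn_Ioi_comp_mul_right_iff (fun s => F s y) 0 (inv_pos.2 hy.1)).2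
        (by rw [zero_mul]; exact h)
      exact Integrable.smul y⁻¹ this
    · refine hF.2.congr ?_
      filter_upwards [ae_restrict_mem measurableSet_Ioo] with y hy
      simp only [Function.uncurry_apply_pair, norm_smul, integral_const_mul]
      rw [Real.norm_of_nonneg (inv_pos.2 hy.1).le, ← smul_eq_mul,
        integral_comp_mul_right_Ioi' (fun s => ‖F s y‖) 0 (inv_pos.2 hy.1), zero_mul]
  rw [integral_integral_swap hF, setIntegral_congr_fun measurableSet_Ioo hscale,
    integral_integral_swap hG]

theorem norm_ofReal_cpow_le_one {x : ℝ} (hx : 1 ≤ x) {a : ℂ} (ha : 0 ≤ a.re) :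
    ‖(x : ℂ) ^ (-a)‖ ≤ 1 := by
  rw [Complex.norm_cpow_eq_rpow_re_of_pos (by linarith)]
  exact Real.rpow_le_one_of_one_le_of_nonpos hx (by simpa using ha)

/-- The Stieltjes transform of Euler's integral is again an Euler-type integral. -/
theorem stieltjes_euler {a p q δ : ℂ} (ha : 0 ≤ a.re) (hp : 0 < p.re) (hq : 0 < q.re)
    (hδ : 0 < δ.re) {z : ℝ} (hz : 0 < z) :
    ∫ s in Ioi (0 : ℝ), (s : ℂ) ^ (p + q - 1) * ((s + z : ℝ) : ℂ) ^ (-(p + q + δ)) *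
      ∫ y in Ioo (0 : ℝ) 1, (y : ℂ) ^ (p - 1) * ((1 - y : ℝ) : ℂ) ^ (q - 1) *
        ((1 + s * y : ℝ) : ℂ) ^ (-a) =
    Complex.betaIntegral (p + δ) q *
      ∫ t in Ioi (0 : ℝ), (t : ℂ) ^ (p - 1) * ((1 + t : ℝ) : ℂ) ^ (-a) *
        ((t + z : ℝ) : ℂ) ^ (-(p + δ)) := by
  set F : ℝ → ℝ → ℂ := fun s y =>
    (s : ℂ) ^ (p + q - 1) * ((s + z : ℝ) : ℂ) ^ (-(p + q + δ)) *
      ((y : ℂ) ^ (p - 1) * ((1 - y : ℝ) : ℂ) ^ (q - 1) * ((1 + s * y : ℝ) : ℂ) ^ (-a)) with hFdef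
  have hm : Measurable (Function.uncurry F) := by
    simp only [hFdef, Function.uncurry_def]
    fun_prop
  have hF : Integrable (Function.uncurry F)
      ((volume.restrict (Ioi 0)).prod (volume.restrict (Ioo 0 1))) := by
    -- As `0 ≤ Re a`, the factor `(1 + s y)^(-a)` has norm at most one, leaving a product of two
    -- Beta integrands.
    have h1 := integrableOn_beta_Ioi one_pos hz (p := p + q) (q := δ) (by simp; positivity) hδ
    have h2 := integrableOn_beta_Ioo hp hq
    refine (Integrable.mul_prod h1 h2).mono hm.aestronglyMeasurable ?_
    rw [Measure.prod_restrict]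
    filter_upwards [ae_restrict_mem (measurableSet_Ioi.prod measurableSet_Ioo)] with x hx
    have hx1 : 0 < x.1 := hx.1
    have hx2 : 0 < x.2 := hx.2.1
    simp only [Function.uncurry_def, hFdef, one_mul]
    rw [← mul_assoc, norm_mul _ (((1 + x.1 * x.2 : ℝ) : ℂ) ^ (-a))]
    exact mul_le_of_le_one_right (norm_nonneg _)
      (norm_ofReal_cpow_le_one (by linarith [mul_pos hx1 hx2]) ha)
  simp_rw [← integral_const_mul]
  refine (integral_integral_comp_div hm hF).trans (setIntegral_congr_fun measurableSet_Ioi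
    fun t ht => ?_)
  have ht : 0 < t := ht
  -- After rescaling, `(1 + s y)^(-a)` no longer depends on `y`, and the `y`-integral is a Beta
  -- integral with `A = t + z`, `B = t`.
  have key : ∀ y ∈ Ioo (0 : ℝ) 1, y⁻¹ • F (t * y⁻¹) y =
      (t : ℂ) ^ (p + q - 1) * ((1 + t : ℝ) : ℂ) ^ (-a) *
      ((y : ℂ) ^ (p + δ - 1) * ((1 - y : ℝ) : ℂ) ^ (q - 1) *
      (((t + z) * y + t * (1 - y) : ℝ) : ℂ) ^ (-(p + δ + q))) := fun y hy => by
    have hy0 : 0 < y := hy.1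
    have h1 : 0 < 1 - y := by linarith [hy.2]
    have h2 : 0 < (t + z) * y + t * (1 - y) := by positivity
    have e1 : t * y⁻¹ + z = ((t + z) * y + t * (1 - y)) / y := by field_simp; ring
    have e2 : 1 + t * y⁻¹ * y = 1 + t := by field_simp
    have e3 : y⁻¹ = Real.exp (- Real.log y) := by rw [Real.exp_neg, Real.exp_log hy0]
    simp only [hFdef]
    rw [e1, e2, ← div_eq_mul_inv, Complex.real_smul, e3, ofReal_cpow_eq_exp (div_pos ht hy0),
      ofReal_cpow_eq_exp (div_pos h2 hy0), ofReal_cpow_eq_exp hy0, ofReal_cpow_eq_exp h1,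
      ofReal_cpow_eq_exp (show 0 < 1 + t by positivity), ofReal_cpow_eq_exp ht,
      ofReal_cpow_eq_exp h2, ofReal_cpow_eq_exp hy0, Real.log_div ht.ne' hy0.ne',
      Real.log_div h2.ne' hy0.ne', Complex.ofReal_exp]
    simp only [← Complex.exp_add]
    congr 1
    push_cast
    ring
  have htz : 0 < t + z := by positivity
  rw [setIntegral_congr_fun measurableSet_Ioo key, integral_const_mul, integral_beta_Ioo htz ht]
  have e4 : (t : ℂ) ^ (p - 1) = (t : ℂ) ^ (p + q - 1) * (t : ℂ) ^ (-q) := by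
    rw [← Complex.cpow_add _ _ (by exact_mod_cast ht.ne')]; congr 1; ring
  rw [e4]
  ring

/-! ### Reduction to a sine. -/

theorem integral_add_cpow_neg_three_halves {x α β : ℝ} (hx : 0 < x) (hα : 0 < α) (hβ : α ≤ β) :
    ∫ r in Ioc α β, ((x + r : ℝ) : ℂ) ^ (-(3 / 2) : ℂ) =
      2 * (((x + α : ℝ) : ℂ) ^ (-(1 / 2) : ℂ) - ((x + β : ℝ) : ℂ) ^ (-(1 / 2) : ℂ)) := by
  rw [← intervalIntegral.integral_of_le hβ,
    intervalIntegral.integral_comp_add_left (fun r : ℝ => (r : ℂ) ^ (-(3 / 2) : ℂ)) x,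
    integral_cpow]
  · rw [show (-(3 / 2) + 1 : ℂ) = -(1 / 2) by norm_num]
    ring
  · right
    refine ⟨fun h => ?_, fun h => ?_⟩
    · have := congrArg Complex.re h
      norm_num at this
    · rw [uIcc_of_le (by linarith)] at h
      linarith [h.1]

/-- The difference is `(1/2) ∫ (x + r)^(-3/2) dr` over `[α, β]`. After Fubini the `x`-integral is a
Beta integral, convergent exactly for `0 < Re w < 3/2`. -/
theorem integral_cpow_mul_sub {w : ℂ} (hw : 0 < w.re) (hw' : w.re < 3 / 2) {α β : ℝ}
    (hα : 0 < α) (hβ : α ≤ β) :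
    ∫ x in Ioi (0 : ℝ), (x : ℂ) ^ (w - 1) *
      (((x + α : ℝ) : ℂ) ^ (-(1 / 2) : ℂ) - ((x + β : ℝ) : ℂ) ^ (-(1 / 2) : ℂ)) =
    Complex.betaIntegral w (3 / 2 - w) / 2 * ∫ r in α..β, (r : ℂ) ^ (w - 3 / 2) := by
  have hq : 0 < (3 / 2 - w).re := by
    have : (3 / 2 : ℂ).re = 3 / 2 := by norm_num
    rw [Complex.sub_re, this]; linarith
  have hF : Integrable (Function.uncurry fun x r : ℝ =>
      (x : ℂ) ^ (w - 1) * ((x + r : ℝ) : ℂ) ^ (-(3 / 2) : ℂ))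
      ((volume.restrict (Ioi 0)).prod (volume.restrict (Ioc α β))) := by
    have h1 := integrableOn_beta_Ioi one_pos hα hw hq
    have h2 : IntegrableOn (fun _ : ℝ => (1 : ℂ)) (Ioc α β) := integrableOn_const (by simp)
    refine (Integrable.mul_prod h1 h2).mono (by fun_prop) ?_
    rw [Measure.prod_restrict]
    filter_upwards [ae_restrict_mem (measurableSet_Ioi.prod measurableSet_Ioc)] with x hx
    have hx1 : 0 < x.1 := hx.1
    have hx2 : α < x.2 := hx.2.1
    simp only [Function.uncurry_def, one_mul, mul_one, norm_mul, add_sub_cancel]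
    gcongr
    rw [Complex.norm_cpow_eq_rpow_re_of_pos (by linarith),
      Complex.norm_cpow_eq_rpow_re_of_pos (by linarith)]
    exact Real.rpow_le_rpow_of_nonpos (by linarith) (by linarith) (by norm_num)
  have h1 : ∀ x ∈ Ioi (0 : ℝ), (x : ℂ) ^ (w - 1) *
      (((x + α : ℝ) : ℂ) ^ (-(1 / 2) : ℂ) - ((x + β : ℝ) : ℂ) ^ (-(1 / 2) : ℂ)) =
      1 / 2 * ∫ r in Ioc α β, (x : ℂ) ^ (w - 1) * ((x + r : ℝ) : ℂ) ^ (-(3 / 2) : ℂ) :=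
    fun x hx => by
      rw [integral_const_mul, integral_add_cpow_neg_three_halves hx hα hβ]
      ring
  have h2 : ∀ r ∈ Ioc α β, ∫ x in Ioi (0 : ℝ),
      (x : ℂ) ^ (w - 1) * ((x + r : ℝ) : ℂ) ^ (-(3 / 2) : ℂ) =
      Complex.betaIntegral w (3 / 2 - w) * (r : ℂ) ^ (w - 3 / 2) := fun r hr => by
    have := integral_beta_Ioi one_pos (hα.trans hr.1) w (3 / 2 - w)
    simp only [one_mul, Complex.ofReal_one, Complex.one_cpow, add_sub_cancel, neg_sub] at this
    rw [this, mul_comm]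
  rw [setIntegral_congr_fun measurableSet_Ioi h1, integral_const_mul, integral_integral_swap hF,
    setIntegral_congr_fun measurableSet_Ioc h2, integral_const_mul,
    intervalIntegral.integral_of_le hβ]
  ring

theorem integral_cpow_mul_sub_exp {ν : ℝ} (hν : ν ≠ 0) (u : ℝ) :
    ∫ x in Ioi (0 : ℝ), (x : ℂ) ^ (1 / 2 + Complex.I * ν - 1) *
      (((x + Real.exp (-u) : ℝ) : ℂ) ^ (-(1 / 2) : ℂ) -
        ((x + Real.exp u : ℝ) : ℂ) ^ (-(1 / 2) : ℂ)) =
    Complex.betaIntegral (1 / 2 + Complex.I * ν) (1 - Complex.I * ν) *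
      (Complex.sin (ν * u) / ν) := by
  -- Both sides are odd in `u`.
  wlog hu : 0 ≤ u generalizing u
  · have := this (-u) (by linarith)
    rw [neg_neg] at this
    rw [← neg_inj, ← integral_neg]
    convert this using 3
    · ring
    · simp; ring
  have hre : (1 / 2 + Complex.I * ν : ℂ).re = 1 / 2 := by simp
  have hI : (Complex.I * ν : ℂ) ≠ 0 := mul_ne_zero Complex.I_ne_zero (by exact_mod_cast hν)
  rw [integral_cpow_mul_sub (by rw [hre]; norm_num) (by rw [hre]; norm_num) (Real.exp_pos _)
    (Real.exp_le_exp.2 (by linarith)), integral_cpow]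
  · rw [show (3 / 2 - (1 / 2 + Complex.I * ν) : ℂ) = 1 - Complex.I * ν by ring,
      show (1 / 2 + Complex.I * ν - 3 / 2 + 1 : ℂ) = Complex.I * ν by ring, div_mul_eq_mul_div,
      mul_div_assoc]
    congr 1
    rw [ofReal_cpow_eq_exp (Real.exp_pos _), ofReal_cpow_eq_exp (Real.exp_pos _), Real.log_exp,
      Real.log_exp, Complex.sin]
    have hν' : (ν : ℂ) ≠ 0 := by exact_mod_cast hν
    have hI2 := Complex.I_sq
    field_simp
    rw [show (Complex.I * ν * ((-u : ℝ) : ℂ)) = -(u * Complex.I * ν) by push_cast; ring, hI2]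
    ring
  · right
    refine ⟨fun h => hI ?_, fun h => ?_⟩
    · linear_combination h
    · rw [uIcc_of_le (Real.exp_le_exp.2 (by linarith))] at h
      linarith [h.1, Real.exp_pos (-u)]

theorem image_mul_div_add {z : ℝ} (hz : 0 < z) :
    (fun t : ℝ => t * (1 + t) / (t + z)) '' Ioi 0 = Ioi 0 := by
  ext x
  constructor
  · rintro ⟨t, ht, rfl⟩
    have ht : 0 < t := ht
    exact mem_Ioi.2 (by positivity)
  · intro hx
    have hx : 0 < x := hx
    -- Root of the discriminant of `t² + (1 - x) t - x z = 0`; the preimage is the positive root.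
    set D := Real.sqrt ((x - 1) ^ 2 + 4 * x * z) with hD
    have hD2 : D ^ 2 = (x - 1) ^ 2 + 4 * x * z := Real.sq_sqrt (by positivity)
    have hDlt : |x - 1| < D := by
      rw [← Real.sqrt_sq_eq_abs]
      exact Real.sqrt_lt_sqrt (sq_nonneg _) (by linarith [show 0 < 4 * x * z by positivity])
    have hpos : 0 < (x - 1 + D) / 2 := by linarith [neg_abs_le (x - 1)]
    refine ⟨(x - 1 + D) / 2, hpos, ?_⟩
    simp only
    rw [div_eq_iff (by positivity)]
    linear_combination hD2 / 4

theorem hasDerivWithinAt_mul_div_add {z t : ℝ} (h : 0 < t + z) :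
    HasDerivWithinAt (fun t : ℝ => t * (1 + t) / (t + z))
      ((t ^ 2 + 2 * t * z + z) / (t + z) ^ 2) (Ioi 0) t := by
  have := ((hasDerivAt_id t).mul ((hasDerivAt_id t).const_add 1)).div
    ((hasDerivAt_id t).add_const z) h.ne'
  refine (this.congr_deriv ?_).hasDerivWithinAt
  simp only [Pi.mul_apply, id]
  congr 1
  ring

theorem injOn_mul_div_add {z : ℝ} (hz : 0 < z) :
    InjOn (fun t : ℝ => t * (1 + t) / (t + z)) (Ioi 0) := by
  intro t ht s hs h
  have ht : 0 < t := ht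
  have hs : 0 < s := hs
  simp only at h
  rw [div_eq_div_iff (by positivity) (by positivity)] at h
  have h2 : (t - s) * (t * s + z + z * (t + s)) = 0 := by linear_combination h
  rcases mul_eq_zero.1 h2 with h3 | h3
  · linarith
  · exact absurd h3 (by positivity)

theorem ofReal_sq_div_cpow_neg_half {X Y : ℝ} (hX : 0 < X) (hY : 0 < Y) :
    ((X ^ 2 / Y : ℝ) : ℂ) ^ (-(1 / 2) : ℂ) = Complex.exp (Real.log Y / 2) * ((X⁻¹ : ℝ) : ℂ) := by
  rw [ofReal_cpow_eq_exp (by positivity), Real.log_div (by positivity) hY.ne', Real.log_pow,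
    show X⁻¹ = Real.exp (-Real.log X) by rw [Real.exp_neg, Real.exp_log hX], Complex.ofReal_exp,
    ← Complex.exp_add]
  congr 1
  push_cast
  ring

/-- With `z = cosh²(u/2)` and `x = t(1 + t)/(t + z)`, the numerator of `x + r` is `t² + (1 + r) t +
r z`. It is a perfect square when `(1 + r)² = 4 r z`, that is, for `r = e^{±u}`, so the half-powers
become rational up to a common factor. -/
theorem sinh_mul_integral_cpow (w : ℂ) (u : ℝ) :
    Complex.sinh u * ∫ t in Ioi (0 : ℝ), (t : ℂ) ^ (w - 1) * ((1 + t : ℝ) : ℂ) ^ (w - 1) *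
      ((t + Real.cosh (u / 2) ^ 2 : ℝ) : ℂ) ^ (-(w + 1 / 2)) =
    ∫ x in Ioi (0 : ℝ), (x : ℂ) ^ (w - 1) *
      (((x + Real.exp (-u) : ℝ) : ℂ) ^ (-(1 / 2) : ℂ) -
        ((x + Real.exp u : ℝ) : ℂ) ^ (-(1 / 2) : ℂ)) := by
  set C := Real.cosh (u / 2) with hC
  set S := Real.sinh (u / 2) with hS
  have hCS : C ^ 2 = S ^ 2 + 1 := Real.cosh_sq _
  have hC0 : 0 < C := Real.cosh_pos _
  have hsinh : Real.sinh u = 2 * S * C := by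
    rw [← Real.sinh_two_mul]; congr 1; ring
  have hadd : C + S = Real.exp (u / 2) := Real.cosh_add_sinh _
  have hsub : C - S = Real.exp (-(u / 2)) := Real.cosh_sub_sinh _
  have hp : 0 < C + S := hadd ▸ Real.exp_pos _
  have hm : 0 < C - S := hsub ▸ Real.exp_pos _
  have he : Real.exp u = (C + S) ^ 2 := by
    rw [hadd, ← Real.exp_nat_mul]; congr 1; push_cast; ring
  have he' : Real.exp (-u) = (C - S) ^ 2 := by
    rw [hsub, ← Real.exp_nat_mul]; congr 1; push_cast; ring
  have hz : 0 < C ^ 2 := by positivity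
  rw [← Complex.ofReal_sinh, hsinh, he, he']
  conv_rhs => rw [← image_mul_div_add hz]
  rw [integral_image_eq_integral_abs_deriv_smul measurableSet_Ioi
    (fun t ht => hasDerivWithinAt_mul_div_add (by have : 0 < t := ht; positivity))
    (injOn_mul_div_add hz), ← integral_const_mul]
  refine setIntegral_congr_fun measurableSet_Ioi fun t ht => ?_
  have ht : 0 < t := ht
  have hY : 0 < t + C ^ 2 := by positivity
  have hX1 : 0 < t + C * (C + S) := by positivity
  have hX2 : 0 < t + C * (C - S) := by positivity
  have e1 : t * (1 + t) / (t + C ^ 2) + (C + S) ^ 2 = (t + C * (C + S)) ^ 2 / (t + C ^ 2) := by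
    field_simp
    linear_combination (-t) * hCS
  have e2 : t * (1 + t) / (t + C ^ 2) + (C - S) ^ 2 = (t + C * (C - S)) ^ 2 / (t + C ^ 2) := by
    field_simp
    linear_combination (-t) * hCS
  -- The numerator of `dx/dt` is the product of the two square roots, so it cancels the denominators
  -- of their reciprocals' difference.
  have hXX : t ^ 2 + 2 * t * C ^ 2 + C ^ 2 = (t + C * (C + S)) * (t + C * (C - S)) := by
    linear_combination (C ^ 2) * (-hCS)
  have e3 : ((t ^ 2 + 2 * t * C ^ 2 + C ^ 2) / (t + C ^ 2) ^ 2) *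
      ((t + C * (C - S))⁻¹ - (t + C * (C + S))⁻¹) = 2 * S * C * ((t + C ^ 2) ^ 2)⁻¹ := by
    rw [hXX]
    field_simp
    ring
  have e4 : ((t + C ^ 2) ^ 2)⁻¹ = Real.exp (-(2 * Real.log (t + C ^ 2))) := by
    rw [Real.exp_neg, two_mul, Real.exp_add, Real.exp_log hY, sq]
  have e5 : ((t * (1 + t) / (t + C ^ 2) : ℝ) : ℂ) ^ (w - 1) =
      (t : ℂ) ^ (w - 1) * ((1 + t : ℝ) : ℂ) ^ (w - 1) * ((t + C ^ 2 : ℝ) : ℂ) ^ (1 - w) := by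
    have h1t : 0 < 1 + t := by positivity
    rw [ofReal_cpow_eq_exp (by positivity), ofReal_cpow_eq_exp ht, ofReal_cpow_eq_exp h1t,
      ofReal_cpow_eq_exp hY, Real.log_div (by positivity) hY.ne', Real.log_mul ht.ne' h1t.ne']
    simp only [← Complex.exp_add]
    congr 1
    push_cast
    ring
  have e6 : ((t + C ^ 2 : ℝ) : ℂ) ^ (-(w + 1 / 2)) = ((t + C ^ 2 : ℝ) : ℂ) ^ (1 - w) *
      Complex.exp (Real.log (t + C ^ 2) / 2) * ((((t + C ^ 2) ^ 2)⁻¹ : ℝ) : ℂ) := by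
    rw [e4, ofReal_cpow_eq_exp hY, ofReal_cpow_eq_exp hY, Complex.ofReal_exp]
    simp only [← Complex.exp_add]
    congr 1
    push_cast
    ring
  have e3' := congrArg (fun r : ℝ => (r : ℂ)) e3
  simp only [Complex.ofReal_mul, Complex.ofReal_sub] at e3'
  rw [abs_of_pos (by positivity), e1, e2, ofReal_sq_div_cpow_neg_half hX1 hY,
    ofReal_sq_div_cpow_neg_half hX2 hY, e5, e6, Complex.real_smul, ← mul_sub]
  simp only [Complex.ofReal_mul]
  linear_combination (-(t : ℂ) ^ (w - 1) * ((1 + t : ℝ) : ℂ) ^ (w - 1) *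
    ((t + C ^ 2 : ℝ) : ℂ) ^ (1 - w) * Complex.exp (Real.log (t + C ^ 2) / 2)) * e3'

/-! ### Measurability, bounds and Fubini for Euler's integral. -/

/-- Euler's integral on the negative real axis, `B(p, q) ₂F₁(a, p; p + q; -s)`. -/
noncomputable def eulerIntegral (a p q : ℂ) (s : ℝ) : ℂ :=
  ∫ y in Ioo (0 : ℝ) 1, (y : ℂ) ^ (p - 1) * ((1 - y : ℝ) : ℂ) ^ (q - 1) *
    ((1 + s * y : ℝ) : ℂ) ^ (-a)

theorem measurable_eulerIntegral (a p q : ℂ) : Measurable (eulerIntegral a p q) := by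
  have h : Measurable (Function.uncurry fun s y : ℝ =>
      (y : ℂ) ^ (p - 1) * ((1 - y : ℝ) : ℂ) ^ (q - 1) * ((1 + s * y : ℝ) : ℂ) ^ (-a)) := by
    simp only [Function.uncurry_def]
    fun_prop
  exact (h.stronglyMeasurable.integral_prod_right (ν := volume.restrict (Ioo (0 : ℝ) 1))).measurable

theorem norm_eulerIntegral_le {a p q : ℂ} (ha : 0 ≤ a.re) (hp : 0 < p.re) (hq : 0 < q.re)
    {s : ℝ} (hs : 0 < s) :
    ‖eulerIntegral a p q s‖ ≤
      ∫ y in Ioo (0 : ℝ) 1, ‖(y : ℂ) ^ (p - 1) * ((1 - y : ℝ) : ℂ) ^ (q - 1)‖ := by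
  refine norm_integral_le_of_norm_le (integrableOn_beta_Ioo hp hq).norm ?_
  filter_upwards [ae_restrict_mem measurableSet_Ioo] with y hy
  rw [norm_mul]
  exact mul_le_of_le_one_right (norm_nonneg _)
    (norm_ofReal_cpow_le_one (by linarith [mul_pos hs hy.1]) ha)

/-- Euler's integral is bounded in `s`, and `cosh² ≥ 1` bounds the kernel by its value at `u = 0`;
what remains is a Beta integrand times `g`. -/
theorem integrable_stieltjes_prod {a p q : ℂ} (ha : 0 ≤ a.re) (hp : 0 < p.re) (hq : 0 < q.re)
    {g : ℝ → ℂ} (hg : IntegrableOn g (Ioc (-Real.pi) Real.pi)) :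
    Integrable (Function.uncurry fun s u : ℝ => (s : ℂ) ^ (p + q - 1) * eulerIntegral a p q s *
      (g u * ((s + Real.cosh (u / 2) ^ 2 : ℝ) : ℂ) ^ (-(p + q + 1 / 2))))
      ((volume.restrict (Ioi 0)).prod (volume.restrict (Ioc (-Real.pi) Real.pi))) := by
  have hpq : 0 < (p + q).re := by simp; positivity
  have h1 := (integrableOn_beta_Ioi one_pos one_pos hpq
    (q := 1 / 2) (by norm_num)).mul_const
      ((∫ y in Ioo (0 : ℝ) 1, ‖(y : ℂ) ^ (p - 1) * ((1 - y : ℝ) : ℂ) ^ (q - 1)‖ : ℝ) : ℂ)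
  refine (Integrable.mul_prod h1 hg).mono ?_ ?_
  · have hm1 : Measurable fun x : ℝ × ℝ => (x.1 : ℂ) ^ (p + q - 1) * eulerIntegral a p q x.1 :=
      Measurable.mul (by fun_prop) ((measurable_eulerIntegral a p q).comp measurable_fst)
    have hm2 : Measurable fun x : ℝ × ℝ => x.1 + Real.cosh (x.2 / 2) ^ 2 :=
      (measurable_fst.add ((Real.measurable_cosh.comp (measurable_snd.div_const 2)).pow_const 2))
    have hm3 : Measurable fun x : ℝ × ℝ =>
        ((x.1 + Real.cosh (x.2 / 2) ^ 2 : ℝ) : ℂ) ^ (-(p + q + 1 / 2)) :=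
      (Complex.measurable_ofReal.comp hm2).pow_const _
    exact hm1.aestronglyMeasurable.mul (hg.aestronglyMeasurable.comp_snd.mul
      hm3.aestronglyMeasurable)
  · rw [Measure.prod_restrict]
    filter_upwards [ae_restrict_mem (measurableSet_Ioi.prod measurableSet_Ioc)] with x hx
    have hx1 : 0 < x.1 := hx.1
    have hc : 1 ≤ Real.cosh (x.2 / 2) ^ 2 := one_le_pow₀ (Real.one_le_cosh _)
    have h2 : ‖((x.1 + Real.cosh (x.2 / 2) ^ 2 : ℝ) : ℂ) ^ (-(p + q + 1 / 2))‖ ≤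
        ‖((x.1 + 1 : ℝ) : ℂ) ^ (-(p + q + 1 / 2))‖ := by
      rw [Complex.norm_cpow_eq_rpow_re_of_pos (by linarith),
        Complex.norm_cpow_eq_rpow_re_of_pos (by linarith)]
      refine Real.rpow_le_rpow_of_nonpos (by linarith) (by linarith) ?_
      rw [Complex.neg_re, Complex.add_re]
      norm_num
      linarith
    have h3 := (norm_eulerIntegral_le ha hp hq hx1).trans (le_abs_self _)
    rw [← Real.norm_eq_abs, ← Complex.norm_real] at h3
    simp only [Function.uncurry_def, one_mul]
    rw [norm_mul, norm_mul, norm_mul (g x.2), norm_mul _ (g x.2), norm_mul, norm_mul,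
      mul_comm ‖g x.2‖, ← mul_assoc, mul_right_comm ‖(x.1 : ℂ) ^ (p + q - 1)‖]
    gcongr

theorem image_one_add_two_mul : (fun s : ℝ => 1 + 2 * s) '' Ioi 0 = Ioi 1 := by
  ext t
  constructor
  · rintro ⟨s, hs, rfl⟩
    have : 0 < s := hs
    exact mem_Ioi.2 (by linarith)
  · intro ht
    have : 1 < t := ht
    exact ⟨(t - 1) / 2, mem_Ioi.2 (by linarith), by simp only; ring⟩

theorem integral_Ioi_one (g : ℝ → ℂ) :
    ∫ t in Ioi (1 : ℝ), g t = 2 * ∫ s in Ioi (0 : ℝ), g (1 + 2 * s) := by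
  rw [← image_one_add_two_mul, integral_image_eq_integral_abs_deriv_smul measurableSet_Ioi
    (f' := fun _ => 2)
    (fun s _ => (((hasDerivAt_id' s).const_mul 2).const_add 1).hasDerivWithinAt.congr_deriv
      (mul_one 2)) (fun s _ t _ h => by linarith), ← integral_const_mul]
  simp

theorem integrableOn_Ioi_one {g : ℝ → ℂ} (h : IntegrableOn (fun s => g (1 + 2 * s)) (Ioi 0)) :
    IntegrableOn g (Ioi 1) := by
  rw [← image_one_add_two_mul, integrableOn_image_iff_integrableOn_abs_deriv_smul measurableSet_Ioi
    (f' := fun _ => 2)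
    (fun s _ => (((hasDerivAt_id' s).const_mul 2).const_add 1).hasDerivWithinAt.congr_deriv
      (mul_one 2)) (fun s _ t _ h => by linarith)]
  exact Integrable.smul _ h

/-! ### The Legendre transform of `f` as a sine coefficient. -/

section LegendreTransform

variable {μ : ℂ} {ν : ℝ} {ψ f : ℝ → ℂ}

theorem legendreP_eq_eulerIntegral (hμ : μ.re < 1 / 2) (ν : ℝ) {s : ℝ} (hs : 0 < s) :
    legendreP μ (Complex.I * ν - 1 / 2) (1 + 2 * s) =
      (((1 + s) / s : ℝ) : ℂ) ^ (μ / 2) /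
        (Complex.Gamma (1 / 2 + Complex.I * ν) * Complex.Gamma (1 / 2 - Complex.I * ν - μ)) *
        eulerIntegral (1 / 2 - Complex.I * ν) (1 / 2 + Complex.I * ν)
          (1 / 2 - Complex.I * ν - μ) s := by
  have hp : 0 < (1 / 2 + Complex.I * ν : ℂ).re := by simp
  have hq : 0 < (1 / 2 - Complex.I * ν - μ : ℂ).re := by simp; linarith
  have hpq : 0 < (1 - μ).re := by simp; linarith
  have e : (1 / 2 + Complex.I * ν : ℂ) + (1 / 2 - Complex.I * ν - μ) = 1 - μ := by ring
  have h := gaussHyp_neg (1 / 2 - Complex.I * ν) hp hq hs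
  rw [Complex.betaIntegral_eq_Gamma_mul_div _ _ hp hq, e] at h
  unfold eulerIntegral legendreP
  rw [h, show (1 + 2 * s + 1) / (1 + 2 * s - 1) = (1 + s) / s by field_simp; ring,
    show (1 - (1 + 2 * s)) / 2 = -s by ring,
    show -(Complex.I * ν - 1 / 2) = (1 / 2 - Complex.I * ν : ℂ) by ring,
    show 1 + (Complex.I * ν - 1 / 2) = (1 / 2 + Complex.I * ν : ℂ) by ring]
  have n1 := Complex.Gamma_ne_zero_of_re_pos hp
  have n2 := Complex.Gamma_ne_zero_of_re_pos hq
  have n3 := Complex.Gamma_ne_zero_of_re_pos hpq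
  generalize Complex.Gamma (1 / 2 + Complex.I * ν) = G₁ at *
  generalize Complex.Gamma (1 / 2 - Complex.I * ν - μ) = G₂ at *
  field_simp

/-- With `t = 1 + 2s` one has `t² - 1 = 4s(1 + s)` and `t + cosh u = 2(s + cosh²(u/2))`. The powers
of `1 + s` cancel, leaving the weight `s^(-μ)` required by the Stieltjes transform. -/
theorem legendreP_mul_eq (hμ : μ.re < 1 / 2) (ν : ℝ)
    (hf : ∀ t : ℝ, 1 < t →
      f t = ((t ^ 2 - 1 : ℝ) : ℂ) ^ (-μ / 2) *
        ∫ u in (-Real.pi)..Real.pi,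
          (ψ u * ((Real.sinh u : ℝ) : ℂ)) / ((t + Real.cosh u : ℝ) : ℂ) ^ (3 / 2 - μ))
    {s : ℝ} (hs : 0 < s) :
    legendreP μ (Complex.I * ν - 1 / 2) (1 + 2 * s) * f (1 + 2 * s) =
      ((2 : ℝ) : ℂ) ^ (-(3 / 2) : ℂ) /
        (Complex.Gamma (1 / 2 + Complex.I * ν) * Complex.Gamma (1 / 2 - Complex.I * ν - μ)) *
      ∫ u in Ioc (-Real.pi) Real.pi, (s : ℂ) ^ (-μ) *
        eulerIntegral (1 / 2 - Complex.I * ν) (1 / 2 + Complex.I * ν)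
          (1 / 2 - Complex.I * ν - μ) s * (ψ u * ((Real.sinh u : ℝ) : ℂ) *
        ((s + Real.cosh (u / 2) ^ 2 : ℝ) : ℂ) ^ (-(3 / 2 - μ))) := by
  have hs1 : 0 < 1 + s := by linarith
  have h1 : ∀ u : ℝ, (ψ u * ((Real.sinh u : ℝ) : ℂ)) /
      ((1 + 2 * s + Real.cosh u : ℝ) : ℂ) ^ (3 / 2 - μ) =
      ((2 : ℝ) : ℂ) ^ (-(3 / 2 - μ)) * (ψ u * ((Real.sinh u : ℝ) : ℂ) *
        ((s + Real.cosh (u / 2) ^ 2 : ℝ) : ℂ) ^ (-(3 / 2 - μ))) := fun u => by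
    have e : 1 + 2 * s + Real.cosh u = 2 * (s + Real.cosh (u / 2) ^ 2) := by
      have h2 := Real.cosh_two_mul (u / 2)
      have h3 := Real.cosh_sq (u / 2)
      rw [show 2 * (u / 2) = u by ring] at h2
      linarith
    rw [e, div_eq_mul_inv, ← Complex.cpow_neg, Complex.ofReal_mul,
      Complex.mul_cpow_ofReal_nonneg zero_le_two (by positivity)]
    ring
  rw [legendreP_eq_eulerIntegral hμ ν hs, hf _ (by linarith), integral_const_mul,
    intervalIntegral.integral_of_le (by linarith [Real.pi_pos])]
  simp_rw [h1]
  rw [integral_const_mul]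
  have e2 : (((1 + s) / s : ℝ) : ℂ) ^ (μ / 2) * (((1 + 2 * s) ^ 2 - 1 : ℝ) : ℂ) ^ (-μ / 2) *
      ((2 : ℝ) : ℂ) ^ (-(3 / 2 - μ)) = ((2 : ℝ) : ℂ) ^ (-(3 / 2) : ℂ) * (s : ℂ) ^ (-μ) := by
    rw [show (1 + 2 * s) ^ 2 - 1 = 2 * 2 * (s * (1 + s)) by ring, ofReal_cpow_eq_exp (by positivity),
      ofReal_cpow_eq_exp (by positivity), ofReal_cpow_eq_exp two_pos, ofReal_cpow_eq_exp two_pos,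
      ofReal_cpow_eq_exp hs, Real.log_div hs1.ne' hs.ne', Real.log_mul (by norm_num) (by positivity),
      Real.log_mul (by norm_num) (by norm_num), Real.log_mul hs.ne' hs1.ne']
    simp only [← Complex.exp_add]
    congr 1
    push_cast
    ring
  linear_combination (eulerIntegral (1 / 2 - Complex.I * ν) (1 / 2 + Complex.I * ν)
          (1 / 2 - Complex.I * ν - μ) s /
        (Complex.Gamma (1 / 2 + Complex.I * ν) * Complex.Gamma (1 / 2 - Complex.I * ν - μ)) *
      ∫ u in Ioc (-Real.pi) Real.pi, (ψ u * ((Real.sinh u : ℝ) : ℂ) *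
        ((s + Real.cosh (u / 2) ^ 2 : ℝ) : ℂ) ^ (-(3 / 2 - μ)))) * e2

/-- Here `a = 1 - p` and `δ = 1/2`, so `t^(p-1)(1 + t)^(-a)` is a power of `t(1 + t)`, as the
quadratic substitution needs. -/
theorem sinh_mul_stieltjes (hμ : μ.re < 1 / 2) (hν : ν ≠ 0) (u : ℝ) :
    Complex.sinh u * ∫ s in Ioi (0 : ℝ), (s : ℂ) ^ (-μ) *
      eulerIntegral (1 / 2 - Complex.I * ν) (1 / 2 + Complex.I * ν)
        (1 / 2 - Complex.I * ν - μ) s *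
        ((s + Real.cosh (u / 2) ^ 2 : ℝ) : ℂ) ^ (-(3 / 2 - μ)) =
    Complex.betaIntegral (1 + Complex.I * ν) (1 / 2 - Complex.I * ν - μ) *
      (Complex.betaIntegral (1 / 2 + Complex.I * ν) (1 - Complex.I * ν) *
        (Complex.sin (ν * u) / ν)) := by
  have ha : 0 ≤ (1 / 2 - Complex.I * ν : ℂ).re := by simp
  have hp : 0 < (1 / 2 + Complex.I * ν : ℂ).re := by simp
  have hq : 0 < (1 / 2 - Complex.I * ν - μ : ℂ).re := by simp; linarith
  have h := stieltjes_euler ha hp hq (δ := 1 / 2) (by norm_num)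
    (z := Real.cosh (u / 2) ^ 2) (pow_pos (Real.cosh_pos _) 2)
  rw [show (1 / 2 + Complex.I * ν : ℂ) + (1 / 2 - Complex.I * ν - μ) - 1 = -μ by ring,
    show (1 / 2 + Complex.I * ν : ℂ) + (1 / 2 - Complex.I * ν - μ) + 1 / 2 = 3 / 2 - μ by ring,
    show (-(1 / 2 - Complex.I * ν) : ℂ) = 1 / 2 + Complex.I * ν - 1 by ring] at h
  rw [← integral_cpow_mul_sub_exp hν, ← sinh_mul_integral_cpow, mul_left_comm,
    show 1 + Complex.I * ν = 1 / 2 + Complex.I * ν + 1 / 2 by ring, ← h]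
  congr 1
  refine setIntegral_congr_fun measurableSet_Ioi fun s _ => ?_
  simp only [eulerIntegral]
  rw [show (-(1 / 2 - Complex.I * ν) : ℂ) = 1 / 2 + Complex.I * ν - 1 by ring]
  ring

theorem Gamma_three_halves : Complex.Gamma (3 / 2) = (Real.sqrt Real.pi : ℂ) / 2 := by
  rw [show (3 / 2 : ℂ) = 1 / 2 + 1 by norm_num, Complex.Gamma_add_one _ (by norm_num),
    Complex.Gamma_one_half_eq, Real.sqrt_eq_rpow, Complex.ofReal_cpow Real.pi_pos.le]
  push_cast
  ring

theorem Gamma_one_add_mul_Gamma_one_sub (hν : ν ≠ 0) :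
    Complex.Gamma (1 + Complex.I * ν) * Complex.Gamma (1 - Complex.I * ν) =
      Real.pi * ν / Complex.sinh (Real.pi * ν) := by
  have hI : (Complex.I * ν : ℂ) ≠ 0 := mul_ne_zero Complex.I_ne_zero (by exact_mod_cast hν)
  rw [add_comm, Complex.Gamma_add_one _ hI, mul_assoc, Complex.Gamma_mul_Gamma_one_sub,
    show (Real.pi * (Complex.I * ν) : ℂ) = Real.pi * ν * Complex.I by ring, Complex.sin_mul_I]
  have := Complex.I_ne_zero
  rw [mul_comm Complex.I, mul_div_assoc', mul_right_comm, mul_div_mul_right _ _ this,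
    mul_comm (ν : ℂ)]

theorem integral_legendreP_mul (hμ : μ.re < 1 / 2) (hν : 0 < ν)
    (hψ : IntegrableOn (fun u => ψ u * ((Real.sinh u : ℝ) : ℂ)) (Ioc (-Real.pi) Real.pi))
    (hf : ∀ t : ℝ, 1 < t →
      f t = ((t ^ 2 - 1 : ℝ) : ℂ) ^ (-μ / 2) *
        ∫ u in (-Real.pi)..Real.pi,
          (ψ u * ((Real.sinh u : ℝ) : ℂ)) / ((t + Real.cosh u : ℝ) : ℂ) ^ (3 / 2 - μ)) :
    IntegrableOn (fun t : ℝ => legendreP μ (Complex.I * ν - 1 / 2) t * f t) (Ioi 1) ∧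
    ∫ t in Ioi (1 : ℝ), legendreP μ (Complex.I * ν - 1 / 2) t * f t =
      Real.sqrt (2 * Real.pi) / (Complex.sinh (Real.pi * ν) * Complex.Gamma (3 / 2 - μ)) *
        ∫ u in (-Real.pi)..Real.pi, ψ u * Complex.sin (ν * u) := by
  have ha : 0 ≤ (1 / 2 - Complex.I * ν : ℂ).re := by simp
  have hp : 0 < (1 / 2 + Complex.I * ν : ℂ).re := by simp
  have hp1 : 0 < (1 + Complex.I * ν : ℂ).re := by simp
  have hm1 : 0 < (1 - Complex.I * ν : ℂ).re := by simp
  have hq : 0 < (1 / 2 - Complex.I * ν - μ : ℂ).re := by simp; linarith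
  have hG := integrable_stieltjes_prod ha hp hq hψ
  rw [show (1 / 2 + Complex.I * ν : ℂ) + (1 / 2 - Complex.I * ν - μ) - 1 = -μ by ring,
    show (1 / 2 + Complex.I * ν : ℂ) + (1 / 2 - Complex.I * ν - μ) + 1 / 2 = 3 / 2 - μ by ring]
    at hG
  have hcongr := fun s (hs : s ∈ Ioi (0 : ℝ)) => legendreP_mul_eq hμ ν hf (mem_Ioi.1 hs)
  refine ⟨integrableOn_Ioi_one (IntegrableOn.congr_fun (Integrable.const_mul hG.integral_prod_left _)
    (fun s hs => (hcongr s hs).symm) measurableSet_Ioi), ?_⟩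
  rw [integral_Ioi_one, setIntegral_congr_fun measurableSet_Ioi hcongr, integral_const_mul,
    integral_integral_swap hG]
  have hu : ∀ u : ℝ, ∫ s in Ioi (0 : ℝ), (s : ℂ) ^ (-μ) *
        eulerIntegral (1 / 2 - Complex.I * ν) (1 / 2 + Complex.I * ν)
          (1 / 2 - Complex.I * ν - μ) s * (ψ u * ((Real.sinh u : ℝ) : ℂ) *
        ((s + Real.cosh (u / 2) ^ 2 : ℝ) : ℂ) ^ (-(3 / 2 - μ))) =
      Complex.betaIntegral (1 + Complex.I * ν) (1 / 2 - Complex.I * ν - μ) *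
        Complex.betaIntegral (1 / 2 + Complex.I * ν) (1 - Complex.I * ν) / ν *
        (ψ u * Complex.sin (ν * u)) := fun u => by
    have h := sinh_mul_stieltjes hμ hν.ne' u
    have h2 : ∀ s : ℝ, (s : ℂ) ^ (-μ) *
        eulerIntegral (1 / 2 - Complex.I * ν) (1 / 2 + Complex.I * ν)
          (1 / 2 - Complex.I * ν - μ) s * (ψ u * ((Real.sinh u : ℝ) : ℂ) *
        ((s + Real.cosh (u / 2) ^ 2 : ℝ) : ℂ) ^ (-(3 / 2 - μ))) =
        (ψ u * ((Real.sinh u : ℝ) : ℂ)) * ((s : ℂ) ^ (-μ) *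
        eulerIntegral (1 / 2 - Complex.I * ν) (1 / 2 + Complex.I * ν)
          (1 / 2 - Complex.I * ν - μ) s *
        ((s + Real.cosh (u / 2) ^ 2 : ℝ) : ℂ) ^ (-(3 / 2 - μ))) := fun s => by ring
    simp_rw [h2]
    rw [integral_const_mul, mul_assoc, Complex.ofReal_sinh, h]
    ring
  simp_rw [hu]
  rw [integral_const_mul, intervalIntegral.integral_of_le (by linarith [Real.pi_pos])]
  simp only [← mul_assoc]
  congr 1
  have e1 : (1 + Complex.I * ν : ℂ) + (1 / 2 - Complex.I * ν - μ) = 3 / 2 - μ := by ring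
  have e2 : (1 / 2 + Complex.I * ν : ℂ) + (1 - Complex.I * ν) = 3 / 2 := by ring
  have hg := Gamma_one_add_mul_Gamma_one_sub hν.ne'
  rw [Complex.betaIntegral_eq_Gamma_mul_div _ _ hp1 hq, Complex.betaIntegral_eq_Gamma_mul_div _ _ hp hm1,
    e1, e2, Gamma_three_halves]
  have n1 := Complex.Gamma_ne_zero_of_re_pos hp
  have n2 := Complex.Gamma_ne_zero_of_re_pos hq
  have n3 : Complex.Gamma (3 / 2 - μ) ≠ 0 := Complex.Gamma_ne_zero_of_re_pos (by
    rw [Complex.sub_re]; norm_num; linarith)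
  have n4 : Complex.sinh (Real.pi * ν) ≠ 0 := by
    rw [← Complex.ofReal_mul, ← Complex.ofReal_sinh]
    exact_mod_cast (Real.sinh_pos_iff.2 (mul_pos Real.pi_pos hν)).ne'
  have n5 : (ν : ℂ) ≠ 0 := by exact_mod_cast hν.ne'
  have n6 : (Real.sqrt Real.pi : ℂ) ≠ 0 := by exact_mod_cast (Real.sqrt_pos.2 Real.pi_pos).ne'
  have hpi : (Real.sqrt Real.pi : ℂ) * Real.sqrt Real.pi = Real.pi := by
    exact_mod_cast Real.mul_self_sqrt Real.pi_pos.le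
  have h2 : ((2 : ℝ) : ℂ) ^ (-(3 / 2) : ℂ) * 4 = Real.sqrt 2 := by
    rw [Real.sqrt_eq_rpow, Complex.ofReal_cpow zero_le_two,
      show (4 : ℂ) = ((2 : ℝ) : ℂ) ^ (2 : ℂ) by norm_num,
      ← Complex.cpow_add _ _ (by norm_num)]
    congr 1
    push_cast
    norm_num
  rw [Real.sqrt_mul zero_le_two, Complex.ofReal_mul, ← h2]
  rw [eq_div_iff n4] at hg
  -- Writing `π` as `√π · √π` leaves a polynomial identity for the final cancellation.
  rw [← hpi] at hg ⊢
  rw [← hpi] at n4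
  generalize Complex.Gamma (1 / 2 + Complex.I * ν) = G₁ at *
  generalize Complex.Gamma (1 / 2 - Complex.I * ν - μ) = G₂ at *
  generalize Complex.Gamma (1 + Complex.I * ν) = G₃ at *
  generalize Complex.Gamma (1 - Complex.I * ν) = G₄ at *
  generalize Complex.Gamma (3 / 2 - μ) = G₅ at *
  generalize Complex.sinh _ = S at *
  generalize ((2 : ℝ) : ℂ) ^ (-(3 / 2) : ℂ) = T at *
  field_simp
  linear_combination 4 * T * hg

end LegendreTransform

/-! ### The incomplete Legendre integral as a sine coefficient. -/

/-- Integration by parts; the boundary terms vanish because `sin(n t)` is zero at `0` and at `π`,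
which ties `ω = π` to integer `n`. -/
theorem integral_cos_mul_cpow (σ : ℂ) {x : ℝ} (hx : 1 < x) (n : ℕ) :
    (n : ℂ) * ∫ t in (0 : ℝ)..Real.pi, Complex.cos (n * t) / ((Real.cosh t + x : ℝ) : ℂ) ^ σ =
      σ * ∫ t in (0 : ℝ)..Real.pi, ((Real.sinh t : ℝ) : ℂ) / ((x + Real.cosh t : ℝ) : ℂ) ^ (σ + 1) *
        Complex.sin (n * t) := by
  have hpos : ∀ t : ℝ, 0 < Real.cosh t + x := fun t => by positivity
  have hu : ∀ t : ℝ, HasDerivAt (fun t : ℝ => ((Real.cosh t + x : ℝ) : ℂ) ^ (-σ))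
      (-σ * ((Real.cosh t + x : ℝ) : ℂ) ^ (-σ - 1) * ((Real.sinh t : ℝ) : ℂ)) t := fun t => by
    have h := (((Complex.hasDerivAt_cosh (t : ℂ)).add_const (x : ℂ)).cpow_const (c := -σ)
      (by rw [← Complex.ofReal_cosh, ← Complex.ofReal_add]
          exact Complex.ofReal_mem_slitPlane.2 (hpos t))).comp_ofReal
    simpa using h
  have hv : ∀ t : ℝ, HasDerivAt (fun t : ℝ => Complex.sin (n * t)) (n * Complex.cos (n * t)) t :=
    fun t => by
      have h := ((Complex.hasDerivAt_sin ((n : ℂ) * t)).comp (t : ℂ)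
        ((hasDerivAt_id (t : ℂ)).const_mul (n : ℂ))).comp_ofReal
      simpa [mul_comm, Function.comp_def] using h
  have hcont : ∀ τ : ℂ, Continuous fun t : ℝ => ((Real.cosh t + x : ℝ) : ℂ) ^ τ := fun τ =>
    continuous_iff_continuousAt.2 fun t => by
      refine ContinuousAt.cpow ?_ continuousAt_const (Complex.ofReal_mem_slitPlane.2 (hpos t))
      exact (Complex.continuous_ofReal.comp (Real.continuous_cosh.add_const x)).continuousAt
  have hsinh : Continuous fun t : ℝ => ((Real.sinh t : ℝ) : ℂ) :=
    Complex.continuous_ofReal.comp Real.continuous_sinh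
  have hcos : Continuous fun t : ℝ => (n : ℂ) * Complex.cos (n * t) := by fun_prop
  have hparts := intervalIntegral.integral_mul_deriv_eq_deriv_mul
    (a := 0) (b := Real.pi) (fun t _ => hu t) (fun t _ => hv t)
    (((continuous_const.mul (hcont _)).mul hsinh).intervalIntegrable _ _)
    (hcos.intervalIntegrable _ _)
  rw [Complex.sin_nat_mul_pi, Complex.ofReal_zero, mul_zero (n : ℂ), Complex.sin_zero, mul_zero,
    mul_zero, sub_zero, zero_sub, ← intervalIntegral.integral_neg] at hparts
  rw [← intervalIntegral.integral_const_mul, ← intervalIntegral.integral_const_mul]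
  convert hparts using 3 with t t
  · rw [Complex.cpow_neg]; ring
  · rw [show -σ - 1 = -(σ + 1) by ring, Complex.cpow_neg, add_comm x]; ring

theorem incompleteLegendreP_pi {μ : ℂ} (hμ : μ.re < 1 / 2) {x : ℝ} (hx : 1 < x) (n : ℕ) :
    (n : ℂ) * Complex.Gamma (1 / 2 + Complex.I * n - μ) *
      Complex.Gamma (1 / 2 - Complex.I * n - μ) *
      incompleteLegendreP μ (Complex.I * n - 1 / 2) x Real.pi =
    ((Real.sqrt (2 / Real.pi) : ℝ) : ℂ) * Complex.Gamma (3 / 2 - μ) *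
      ((x ^ 2 - 1 : ℝ) : ℂ) ^ (-μ / 2) *
      ∫ t in (0 : ℝ)..Real.pi, ((Real.sinh t : ℝ) : ℂ) / ((x + Real.cosh t : ℝ) : ℂ) ^ (3 / 2 - μ) *
        Complex.sin (n * t) := by
  have hp : 0 < (1 / 2 + Complex.I * n - μ : ℂ).re := by simp; linarith
  have hq : 0 < (1 / 2 - Complex.I * n - μ : ℂ).re := by simp; linarith
  have h0 : (1 / 2 - μ : ℂ) ≠ 0 := fun h => by
    have := congrArg Complex.re h
    simp at this
    linarith
  have h := integral_cos_mul_cpow (1 / 2 - μ) hx n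
  have hcos : ∀ t : ℝ, Complex.cosh ((t : ℂ) * (Complex.I * n - 1 / 2 + 1 / 2)) =
      Complex.cos (n * t) := fun t => by
    rw [← Complex.cosh_mul_I]; congr 1; ring
  rw [show 1 / 2 - μ + 1 = 3 / 2 - μ by ring] at h
  unfold incompleteLegendreP
  simp_rw [hcos]
  rw [show 1 + (Complex.I * n - 1 / 2) - μ = (1 / 2 + Complex.I * n - μ : ℂ) by ring,
    show -(Complex.I * n - 1 / 2) - μ = (1 / 2 - Complex.I * n - μ : ℂ) by ring,
    show 3 / 2 - μ = 1 / 2 - μ + 1 by ring, Complex.Gamma_add_one _ h0,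
    show 1 / 2 - μ + 1 = 3 / 2 - μ by ring]
  have n1 := Complex.Gamma_ne_zero_of_re_pos hp
  have n2 := Complex.Gamma_ne_zero_of_re_pos hq
  generalize Complex.Gamma (1 / 2 + Complex.I * n - μ) = G₁ at *
  generalize Complex.Gamma (1 / 2 - Complex.I * n - μ) = G₂ at *
  generalize Complex.Gamma (1 / 2 - μ) = G₃ at *
  generalize ((x ^ 2 - 1 : ℝ) : ℂ) ^ (-μ / 2) = X at *
  rw [show ∀ r i : ℂ, (n : ℂ) * G₁ * G₂ * (r * (G₃ * X / (G₁ * G₂)) * i) =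
    r * G₃ * X * (n * i) from fun r i => by field_simp, h]
  ring

/-! ### Parseval's identity for sine coefficients. -/

/-- Parseval's identity for the bilinear pairing on an interval. -/
theorem hasSum_fourierCoeffOn_neg_mul {a b : ℝ} (hab : a < b) {g h : ℝ → ℂ}
    (hg : MemLp g 2 (volume.restrict (Ioc a b))) (hh : MemLp h 2 (volume.restrict (Ioc a b))) :
    HasSum (fun n : ℤ => fourierCoeffOn hab g (-n) * fourierCoeffOn hab h n)
      ((b - a)⁻¹ • ∫ u in a..b, g u * h u) := by
  have := Fact.mk (by linarith : 0 < b - a)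
  -- Conjugating `g` makes the sesquilinear identity bilinear, at the cost of `n ↦ -n` in its
  -- coefficients.
  have hgc : MemLp (fun u => (starRingEnd ℂ) (g u)) 2 (volume.restrict (Ioc a b)) := hg.star
  rw [← add_sub_cancel a b] at hgc hh
  have h1 := hgc.memLp_liftIoc.haarAddCircle
  have h2 := hh.memLp_liftIoc.haarAddCircle
  have hcoeff : ∀ n : ℤ, (starRingEnd ℂ) (fourierCoeffOn hab (fun u => (starRingEnd ℂ) (g u)) n) =
      fourierCoeffOn hab g (-n) := fun n => by
    rw [fourierCoeffOn_eq_integral, fourierCoeffOn_eq_integral, Complex.real_smul,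
      Complex.real_smul, map_mul, Complex.conj_ofReal, ← intervalIntegral.intervalIntegral_conj]
    congr 2
    ext u
    rw [smul_eq_mul, map_mul, Complex.conj_conj, ← fourier_neg, smul_eq_mul]
  convert! fourierBasis.hasSum_inner_mul_inner h1.toLp h2.toLp using 1
  · ext n
    rw [← hcoeff, ← inner_conj_symm (h1.toLp), ← fourierBasis.repr_apply_apply,
      ← fourierBasis.repr_apply_apply, fourierBasis_repr, fourierBasis_repr,
      fourierCoeff_congr_ae h1.coeFn_toLp, fourierCoeff_congr_ae h2.coeFn_toLp,
      fourierCoeff_liftIoc_eq, fourierCoeff_liftIoc_eq]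
    simp
  · rw [MeasureTheory.L2.inner_def]
    nth_rw 2 [← add_sub_cancel a b]
    rw [← AddCircle.integral_liftIoc_eq_intervalIntegral, ← AddCircle.integral_haarAddCircle]
    apply integral_congr_ae
    filter_upwards [h1.coeFn_toLp, h2.coeFn_toLp] with x hx1 hx2
    rw [hx1, hx2, RCLike.inner_apply']
    change _ = (starRingEnd ℂ) ((starRingEnd ℂ) _) * _
    rw [Complex.conj_conj]
    rfl

theorem fourierCoeffOn_pi (g : ℝ → ℂ) (n : ℤ) :
    fourierCoeffOn (neg_lt_self Real.pi_pos) g n =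
      (2 * Real.pi)⁻¹ * ∫ u in (-Real.pi)..Real.pi, Complex.exp (-(n * u * Complex.I)) * g u := by
  have hpi : (Real.pi : ℂ) ≠ 0 := by exact_mod_cast Real.pi_ne_zero
  rw [fourierCoeffOn_eq_integral, Complex.real_smul]
  congr 1
  · push_cast
    rw [one_div]
    ring
  · congr 1
    ext u
    rw [fourier_coe_apply, smul_eq_mul]
    congr 2
    push_cast
    field_simp
    ring

theorem fourierCoeffOn_neg_sub {g : ℝ → ℂ} (hg : IntervalIntegrable g volume (-Real.pi) Real.pi)
    (n : ℤ) :
    fourierCoeffOn (neg_lt_self Real.pi_pos) g (-n) - fourierCoeffOn (neg_lt_self Real.pi_pos) g n =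
      Complex.I / Real.pi * ∫ u in (-Real.pi)..Real.pi, g u * Complex.sin (n * u) := by
  have hi : ∀ k : ℤ, IntervalIntegrable (fun u : ℝ => Complex.exp (-(k * u * Complex.I)) * g u)
      volume (-Real.pi) Real.pi := fun k =>
    hg.continuousOn_mul (Continuous.continuousOn (by fun_prop))
  rw [fourierCoeffOn_pi, fourierCoeffOn_pi, ← mul_sub, ← intervalIntegral.integral_sub (hi _) (hi _),
    ← intervalIntegral.integral_const_mul, ← intervalIntegral.integral_const_mul]
  congr 1
  ext u
  rw [Complex.sin]
  push_cast
  rw [mul_inv, show -(-(n : ℂ) * u * Complex.I) = n * u * Complex.I by ring,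
    show -(n * u : ℂ) * Complex.I = -(n * u * Complex.I) by ring]
  linear_combination ((Real.pi : ℂ)⁻¹ * g u / 2 * (Complex.exp (n * u * Complex.I) -
    Complex.exp (-(n * u * Complex.I)))) * Complex.I_sq

theorem fourierCoeffOn_neg_of_odd {h : ℝ → ℂ} (hodd : ∀ u, h (-u) = -h u) (n : ℤ) :
    fourierCoeffOn (neg_lt_self Real.pi_pos) h (-n) =
      -fourierCoeffOn (neg_lt_self Real.pi_pos) h n := by
  rw [fourierCoeffOn_pi, fourierCoeffOn_pi, ← mul_neg, ← intervalIntegral.integral_neg]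
  congr 1
  have := intervalIntegral.integral_comp_neg (a := -Real.pi) (b := Real.pi)
    (fun u : ℝ => Complex.exp (-(((-n : ℤ) : ℂ) * u * Complex.I)) * h u)
  rw [neg_neg] at this
  rw [← this]
  congr 1
  ext u
  rw [hodd]
  push_cast
  ring_nf

/-- Parseval's identity for sine coefficients, when one of the functions is odd. -/
theorem hasSum_sin_mul_sin {g h : ℝ → ℂ} (hg : MemLp g 2 (volume.restrict (Ioc (-Real.pi) Real.pi)))
    (hh : MemLp h 2 (volume.restrict (Ioc (-Real.pi) Real.pi))) (hodd : ∀ u, h (-u) = -h u) :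
    HasSum (fun n : ℕ+ => 1 / (Real.pi : ℂ) *
      ((∫ u in (-Real.pi)..Real.pi, g u * Complex.sin (n * u)) *
        ∫ u in (-Real.pi)..Real.pi, h u * Complex.sin (n * u)))
      (∫ u in (-Real.pi)..Real.pi, g u * h u) := by
  have hpi : (Real.pi : ℂ) ≠ 0 := by exact_mod_cast Real.pi_ne_zero
  have hle : -Real.pi ≤ Real.pi := by linarith [Real.pi_pos]
  have hgi : IntervalIntegrable g volume (-Real.pi) Real.pi :=
    (intervalIntegrable_iff_integrableOn_Ioc_of_le hle).2 (hg.integrable one_le_two)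
  have hhi : IntervalIntegrable h volume (-Real.pi) Real.pi :=
    (intervalIntegrable_iff_integrableOn_Ioc_of_le hle).2 (hh.integrable one_le_two)
  have hsum := (hasSum_fourierCoeffOn_neg_mul (neg_lt_self Real.pi_pos) hg hh).nat_add_neg
  -- Folding `ℤ` onto `ℕ` counts the index `0` twice; oddness makes that term vanish.
  have h0 : fourierCoeffOn (neg_lt_self Real.pi_pos) h 0 = 0 := by
    have := fourierCoeffOn_neg_of_odd hodd 0
    rw [neg_zero] at this
    exact self_eq_neg.1 this
  have hterm : ∀ n : ℕ, fourierCoeffOn (neg_lt_self Real.pi_pos) g (-(n : ℤ)) *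
        fourierCoeffOn (neg_lt_self Real.pi_pos) h n +
      fourierCoeffOn (neg_lt_self Real.pi_pos) g (- -(n : ℤ)) *
        fourierCoeffOn (neg_lt_self Real.pi_pos) h (-(n : ℤ)) =
      (2 * Real.pi : ℂ)⁻¹ * (1 / (Real.pi : ℂ) *
      ((∫ u in (-Real.pi)..Real.pi, g u * Complex.sin (n * u)) *
        ∫ u in (-Real.pi)..Real.pi, h u * Complex.sin (n * u))) := fun n => by
    have e1 := fourierCoeffOn_neg_sub hgi n
    have e2 := fourierCoeffOn_neg_sub hhi n
    have e3 := fourierCoeffOn_neg_of_odd hodd n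
    rw [Int.cast_natCast] at e1 e2
    rw [neg_neg]
    rw [e3] at e2 ⊢
    set A := ∫ u in (-Real.pi)..Real.pi, g u * Complex.sin (n * u)
    set B := ∫ u in (-Real.pi)..Real.pi, h u * Complex.sin (n * u)
    have e4 : fourierCoeffOn (neg_lt_self Real.pi_pos) h n = -(Complex.I / Real.pi * B) / 2 := by
      linear_combination (-1 / 2) * e2
    rw [mul_neg, ← sub_eq_add_neg, ← sub_mul, e1, e4]
    rw [mul_inv, one_div, div_eq_mul_inv]
    linear_combination (-(Real.pi : ℂ)⁻¹ ^ 2 * A * B / 2) * Complex.I_sq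
  simp only [hterm, neg_zero, h0, mul_zero, add_zero] at hsum
  have hsum2 := hsum.mul_left (2 * Real.pi : ℂ)
  have h2pi : (2 * Real.pi : ℂ) ≠ 0 := mul_ne_zero two_ne_zero hpi
  simp only [mul_inv_cancel_left₀ h2pi] at hsum2
  rw [Complex.real_smul, show ((Real.pi - -Real.pi)⁻¹ : ℝ) = (2 * Real.pi)⁻¹ by ring,
    Complex.ofReal_inv, Complex.ofReal_mul, Complex.ofReal_ofNat, mul_inv_cancel_left₀ h2pi] at hsum2
  refine (hasSum_pnat_iff (f := fun n : ℕ => 1 / (Real.pi : ℂ) *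
      ((∫ u in (-Real.pi)..Real.pi, g u * Complex.sin (n * u)) *
        ∫ u in (-Real.pi)..Real.pi, h u * Complex.sin (n * u)))
    (a := ∫ u in (-Real.pi)..Real.pi, g u * h u)).2 ?_
  simpa using hsum2

theorem memLp_two_of_continuousOn {g : ℝ → ℂ} (hg : ContinuousOn g (Icc (-Real.pi) Real.pi)) :
    MemLp g 2 (volume.restrict (Ioc (-Real.pi) Real.pi)) := by
  obtain ⟨C, hC⟩ := isCompact_Icc.exists_bound_of_continuousOn hg
  refine MemLp.of_bound ((hg.mono Ioc_subset_Icc_self).aestronglyMeasurable measurableSet_Ioc) C ?_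
  filter_upwards [ae_restrict_mem measurableSet_Ioc] with u hu
  exact hC u (Ioc_subset_Icc_self hu)

theorem continuous_sinh_div_cpow (τ : ℂ) {x : ℝ} (hx : 1 < x) :
    Continuous fun u : ℝ => ((Real.sinh u : ℝ) : ℂ) / ((x + Real.cosh u : ℝ) : ℂ) ^ τ := by
  have hpos : ∀ u : ℝ, 0 < x + Real.cosh u := fun u => by positivity
  refine (Complex.continuous_ofReal.comp Real.continuous_sinh).div
    (continuous_iff_continuousAt.2 fun u => ?_) fun u => ?_
  · refine ContinuousAt.cpow ?_ continuousAt_const (Complex.ofReal_mem_slitPlane.2 (hpos u))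
    exact (Complex.continuous_ofReal.comp (continuous_const.add Real.continuous_cosh)).continuousAt
  · rw [ofReal_cpow_eq_exp (hpos u)]
    exact Complex.exp_ne_zero _

theorem integral_sinh_mul_sin (τ : ℂ) {x : ℝ} (hx : 1 < x) (n : ℕ) :
    ∫ u in (-Real.pi)..Real.pi, ((Real.sinh u : ℝ) : ℂ) / ((x + Real.cosh u : ℝ) : ℂ) ^ τ *
        Complex.sin (n * u) =
      2 * ∫ u in (0 : ℝ)..Real.pi, ((Real.sinh u : ℝ) : ℂ) / ((x + Real.cosh u : ℝ) : ℂ) ^ τ *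
        Complex.sin (n * u) := by
  have hc : Continuous fun u : ℝ => ((Real.sinh u : ℝ) : ℂ) / ((x + Real.cosh u : ℝ) : ℂ) ^ τ *
      Complex.sin (n * u) := (continuous_sinh_div_cpow τ hx).mul (by fun_prop)
  rw [← intervalIntegral.integral_add_adjacent_intervals (b := 0) (hc.intervalIntegrable _ _)
    (hc.intervalIntegrable _ _), two_mul]
  congr 1
  have h := intervalIntegral.integral_comp_neg (a := 0) (b := Real.pi)
    (fun u : ℝ => ((Real.sinh u : ℝ) : ℂ) / ((x + Real.cosh u : ℝ) : ℂ) ^ τ *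
      Complex.sin (n * u))
  rw [neg_zero] at h
  rw [← h]
  congr 1
  ext u
  rw [Real.sinh_neg, Real.cosh_neg, Complex.ofReal_neg, Complex.ofReal_neg, mul_neg, Complex.sin_neg]
  ring

/-! ### The expansion. -/

theorem theorem2 (μ : ℂ) (hμ : μ.re < 1 / 2) (ψ : ℝ → ℂ)
    (hper : Function.Periodic ψ (2 * Real.pi))
    (hψ : ContDiffOn ℝ 1 ψ (Set.Icc (-Real.pi) Real.pi))
    (f : ℝ → ℂ)
    (hf : ∀ t : ℝ, 1 < t →
      f t = ((t ^ 2 - 1 : ℝ) : ℂ) ^ (-μ / 2) *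
        ∫ u in (-Real.pi)..Real.pi,
          (ψ u * ((Real.sinh u : ℝ) : ℂ)) / ((t + Real.cosh u : ℝ) : ℂ) ^ (3 / 2 - μ)) :
    (∀ n : ℕ+, IntegrableOn
      (fun t : ℝ => legendreP μ (Complex.I * (n : ℂ) - 1 / 2) t * f t) (Set.Ioi 1)) ∧
    ∀ x : ℝ, 1 < x →
      HasSum (fun n : ℕ+ =>
        1 / (Real.pi : ℂ) *
          ((n : ℂ) * Complex.sinh ((Real.pi : ℂ) * (n : ℂ)) *
            Complex.Gamma (1 / 2 + Complex.I * (n : ℂ) - μ) *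
            Complex.Gamma (1 / 2 - Complex.I * (n : ℂ) - μ) *
            incompleteLegendreP μ (Complex.I * (n : ℂ) - 1 / 2) x Real.pi *
            ∫ t in Set.Ioi (1 : ℝ),
              legendreP μ (Complex.I * (n : ℂ) - 1 / 2) t * f t))
        (f x) := by
  have hψc := hψ.continuousOn
  have hψs : IntegrableOn (fun u => ψ u * ((Real.sinh u : ℝ) : ℂ)) (Ioc (-Real.pi) Real.pi) :=
    (hψc.mul (Complex.continuous_ofReal.comp
      Real.continuous_sinh).continuousOn).integrableOn_Icc.mono_set Ioc_subset_Icc_self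
  have hT := fun n : ℕ+ => integral_legendreP_mul (ν := (n : ℝ)) hμ
    (by exact_mod_cast n.pos) hψs hf
  simp only [Complex.ofReal_natCast] at hT
  refine ⟨fun n => (hT n).1, fun x hx => ?_⟩
  have hpars := (hasSum_sin_mul_sin (memLp_two_of_continuousOn hψc)
    (memLp_two_of_continuousOn (continuous_sinh_div_cpow (3 / 2 - μ) hx).continuousOn)
    (fun u => by rw [Real.sinh_neg, Real.cosh_neg, Complex.ofReal_neg, neg_div])).mul_left
      (((x ^ 2 - 1 : ℝ) : ℂ) ^ (-μ / 2))
  rw [hf x hx]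
  convert! hpars using 1
  · ext n
    have hG : Complex.Gamma (3 / 2 - μ) ≠ 0 := Complex.Gamma_ne_zero_of_re_pos (by
      rw [Complex.sub_re]; norm_num; linarith)
    have hS : Complex.sinh (Real.pi * n) ≠ 0 := by
      rw [← Complex.ofReal_natCast, ← Complex.ofReal_mul, ← Complex.ofReal_sinh]
      exact_mod_cast (Real.sinh_pos_iff.2 (mul_pos Real.pi_pos (by exact_mod_cast n.pos))).ne'
    have h1 := incompleteLegendreP_pi hμ hx n
    -- This `2` matches the one from folding the even integrand `K(u) sin nu` onto `[0, π]`.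
    have hsqrt : ((Real.sqrt (2 / Real.pi) : ℝ) : ℂ) * Real.sqrt (2 * Real.pi) = 2 := by
      rw [← Complex.ofReal_mul, ← Real.sqrt_mul (by positivity),
        show 2 / Real.pi * (2 * Real.pi) = 2 ^ 2 by field_simp, Real.sqrt_sq zero_le_two]
      norm_num
    rw [(hT n).2, integral_sinh_mul_sin _ hx]
    set A := ∫ u in (-Real.pi)..Real.pi, ψ u * Complex.sin (n * u)
    set B := ∫ u in (0 : ℝ)..Real.pi, ((Real.sinh u : ℝ) : ℂ) /
      ((x + Real.cosh u : ℝ) : ℂ) ^ (3 / 2 - μ) * Complex.sin (n * u)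
    rw [show ∀ a b c d e K : ℂ, a * b * c * d * e * K = (a * c * d * e) * (b * K) from
      fun a b c d e K => by ring, h1]
    generalize Complex.Gamma (3 / 2 - μ) = G at *
    generalize Complex.sinh (Real.pi * n) = S at *
    generalize ((x ^ 2 - 1 : ℝ) : ℂ) ^ (-μ / 2) = X at *
    rw [show S * (Real.sqrt (2 * Real.pi) / (S * G) * A) = Real.sqrt (2 * Real.pi) / G * A by
      field_simp]
    rw [show ((Real.sqrt (2 / Real.pi) : ℝ) : ℂ) * G * X * B * (Real.sqrt (2 * Real.pi) / G * A) =
      (((Real.sqrt (2 / Real.pi) : ℝ) : ℂ) * Real.sqrt (2 * Real.pi)) * X * B * A by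
      field_simp, hsqrt]
    ring
  · congr 2
    ext u
    rw [mul_div_assoc]
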